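/- Let $\Sigma=\{a,b\}$. Words $x,y$ are abelian equivalent ($x\sim y$) if $|x|_c=|y|_c$ for $c\in\Sigma$. An internal abelian-border of a pair $(u,v)$ is a pair $(x,y)$ with $x\sim y$, $x$ a nonempty proper suffix of $u$ and $y$ a proper prefix of $v$; an external abelian-border is defined likewise with $x$ a nonempty proper prefix of $u$ and $y$ a proper suffix of $v$. The pair $(u,v)$ is mutually abelian-bordered (MAB) if it has both. Let $\mathrm{lsb}(u,v)$ be the length of the shortest internal abelian-border of $(u,v)$. For an MAB pair with $|u|=|v|=n$ put $i=\mathrm{lsb}(u,v)$ and $j=\mathrm{lsb}(v,u)$; its overlap length is $i+j-n$. A lattice path is a finite sequence of unit steps right ($a$) or up ($b$) in $\mathbb Z^2$; $p\cap q$ is the set of lattice points common to $p$ and $q$. $N_A^{B,C}$ is the number of pairs of paths ($A\to B$, $A\to C$) meeting only in $A$; $N_{A,B}^{C}$ is the number of pairs of paths ($A\to C$, $B\to C$) meeting only in $C$; ${}_AN_B^C$ is the number of triples $(p,q,p')$ of paths with $p:A\to C$, $q:B\to C$, $p'$ the path from $B$ with the same step sequence as $p$, $p\cap q=\{C\}$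 and $q\cap p'=\{B\}$. Binomial coefficients $\binom xy$ are $0$ unless $0\le y\le x$. Write $O=(0,0)$ and, for given $n,i,j,l_1,l_2,k,m$, put $A_{l_1}=(l_1,n-i-l_1)$, $A_{l_2}=(l_2,n-i-l_2)$, $A_k=(k,j-k)$, $k'=k+l_1-l_2$, $A_{k'}=(k',j-k')$, $A_m=(m,n-m)$. **Theorem.** For every $n$, the number of MAB pairs of words of length $n$ with overlap length at least $3$ is $$2\sum_{j}\sum_{i}\sum_{l_2=0}^{n-i-2}\ \sum_{l_1=l_2+2}^{n-i}\ \sum_{k=l_1}^{i+j-n+l_2}\ \sum_{m=k'}^{n-j+k} N_O^{A_{l_1},A_{l_2}}\cdot{}_{A_{l_2}}N_{A_{l_1}}^{A_k}\cdot N_{A_k,A_{k'}}^{A_m},$$ where $i,j$ run over $1\le i,j\le n-1$ with $i+j-n\ge 3$; and for each fixed $g\ge3$ the number of those with overlap length exactly $g$ is the same sum restricted to $i+j-n=g$. For all indices in these ranges, with $g=i+j-n$, the factors are as follows. 1. $N_O^{A_{l_1},A_{l_2}}=\frac{l_1-l_2}{n-i}\binom{n-i}{l_1}\binom{n-i}{l_2}$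 and $N_{A_k,A_{k'}}^{A_m}=\frac{l_1-l_2}{n-j}\binom{n-j}{m-k}\binom{n-j}{m-k'}$. 2. If $j-k=n-i-l_2$ (that is, $A_k$ and $A_{l_2}$ have the same ordinate), then ${}_{A_{l_2}}N_{A_{l_1}}^{A_k}=\binom{g-2}{k-l_1}$. 3. Otherwise ${}_{A_{l_2}}N_{A_{l_1}}^{A_k}$ equals $$\sum_{r=2}^{\lfloor (g+1)/2\rfloor}\ \sum_{D}\ \sum_{C}\binom{n_1-1}{l_2-l_1+n_1+s_1}\binom{n_2}{t_2-s_1}\binom{n_{2r-1}-1}{n_{2r-1}-t_{2r-2}}\prod_{e=2}^{r-1}\binom{n_{2e-1}}{n_{2e-1}+s_{2e-1}-t_{2e-2}}\binom{n_{2e}}{t_{2e}-s_{2e-1}}.$$ Here $D$ is the set of tuples $(n_1,\dots,n_{2r-1})$ of positive integers with $\sum_{e=1}^{r}n_{2e-1}=k-l_2$ and $\sum_{e=1}^{r-1}n_{2e}=g-(k-l_2)$ (so their total is $g$). Given such a tuple, write $l_1-l_2=n_{2l+1}''+n_{2l+3}+\cdots+n_{2r-1}$ with $0\le l\le r-1$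 and $0<n_{2l+1}''\le n_{2l+1}$; then $C$ is the set of integer tuples $(s_1,t_2,s_3,t_4,\dots,s_{2r-3},t_{2r-2})$ with (for those entries that occur in the tuple) - $1\le s_1,t_2,\dots,s_{2l-1},t_{2l}\le l_1-l_2-1$; - $1\le s_{2l+1},t_{2l+2}\le l_1-l_2-n_{2l+1}''$; - $1\le s_{2l+s},t_{2l+s+1}\le l_1-l_2-n_{2l+1}''-n_{2l+3}-\cdots-n_{2l+s}$ for every odd $s$ with $3\le s\le 2r-2l-3$. -/

import Mathlib

namespace MAB

/-- The binary alphabet; `true` is the letter `a`, `false` is the letter `b`. -/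
abbrev Letter := Bool

/-- Binary words. -/
abbrev Word := List Letter

/-- Abelian equivalence: the same number of occurrences of every letter. -/
def AbelianEquiv (x y : Word) : Prop := ∀ c : Letter, x.count c = y.count c

/-- `(x, y)` is an internal abelian-border of `(u, v)`: `x` is a nonempty proper suffix of `u`,
`y` is a proper prefix of `v`, and `x`, `y` are abelian equivalent. -/
def IsInternalBorder (u v x y : Word) : Prop :=
  (x ≠ [] ∧ x <:+ u ∧ x ≠ u) ∧ (y <+: v ∧ y ≠ v) ∧ AbelianEquiv x y

/-- `(x, y)` is an external abelian-border of `(u, v)`: `x` is a nonempty proper prefix of `u`,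
`y` is a proper suffix of `v`, and `x`, `y` are abelian equivalent. -/
def IsExternalBorder (u v x y : Word) : Prop :=
  (x ≠ [] ∧ x <+: u ∧ x ≠ u) ∧ (y <:+ v ∧ y ≠ v) ∧ AbelianEquiv x y

/-- `(u, v)` has both an internal and an external abelian-border. -/
def MutuallyAbelianBordered (u v : Word) : Prop :=
  (∃ x y, IsInternalBorder u v x y) ∧ (∃ x y, IsExternalBorder u v x y)

/-- The length of the shortest internal abelian-border of `(u, v)`; it is `0` when there is none
(the shortest internal abelian-border is then the pair of empty words). -/
noncomputable def lsb (u v : Word) : ℕ :=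
  sInf {t : ℕ | ∃ x y, IsInternalBorder u v x y ∧ x.length = t}

/-- The mutually abelian-bordered pairs of binary words of length `n`. -/
def mabPairs (n : ℕ) : Set (Word × Word) :=
  {w | w.1.length = n ∧ w.2.length = n ∧ MutuallyAbelianBordered w.1 w.2}

/-- The overlap length `i + j - n` (as an integer), where `i = lsb(u, v)` and `j = lsb(v, u)`. -/
noncomputable def overlap (n : ℕ) (w : Word × Word) : ℤ :=
  (lsb w.1 w.2 : ℤ) + (lsb w.2 w.1 : ℤ) - (n : ℤ)

/-- Lattice points. -/
abbrev Pt := ℤ × ℤ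

/-- A unit step: the letter `a` moves right (east), the letter `b` moves up (north). -/
def step (A : Pt) (c : Letter) : Pt := if c then (A.1 + 1, A.2) else (A.1, A.2 + 1)

/-- A lattice path: a starting point and a finite sequence of unit steps to the right or up. -/
@[ext] structure LatticePath where
  start : Pt
  word : Word

/-- The points visited when the word is read from a given point. -/
def visited : Pt → Word → Set Pt
  | A, [] => {A}
  | A, c :: w => insert A (visited (step A c) w)

namespace LatticePath

/-- The end point of a path. -/
def finish (p : LatticePath) : Pt := p.word.foldl step p.start

/-- The lattice points on a path, both end points included. -/
def points (p : LatticePath) : Set Pt := visited p.start p.word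

/-- `p` is a path from `A` to `B`. -/
def IsFromTo (p : LatticePath) (A B : Pt) : Prop := p.start = A ∧ p.finish = B

end LatticePath

/-- `N_A^{B, C}`: the number of pairs of lattice paths, from `A` to `B` and from `A` to `C`, that
have only `A` in common. -/
noncomputable def numDiverging (A B C : Pt) : ℕ :=
  Set.ncard {pq : LatticePath × LatticePath |
    pq.1.IsFromTo A B ∧ pq.2.IsFromTo A C ∧ pq.1.points ∩ pq.2.points = {A}}

/-- `N_{A, B}^C`: the number of pairs of lattice paths, from `A` to `C` and from `B` to `C`, that
have only `C` in common. -/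
noncomputable def numConverging (A B C : Pt) : ℕ :=
  Set.ncard {pq : LatticePath × LatticePath |
    pq.1.IsFromTo A C ∧ pq.2.IsFromTo B C ∧ pq.1.points ∩ pq.2.points = {C}}

/-- `_A N_B^C`: the number of triples `(p, q, p')` of lattice paths such that `p` goes from `A` to
`C`, `q` goes from `B` to `C`, `p'` starts at `B` and has the word of `p`, `p` and `q` have only `C`
in common, and `q` and `p'` have only `B` in common. -/
noncomputable def numTriples (A B C : Pt) : ℕ :=
  Set.ncard {t : LatticePath × LatticePath × LatticePath |
    t.1.IsFromTo A C ∧ t.2.1.IsFromTo B C ∧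
    (t.2.2.start = B ∧ t.2.2.word = t.1.word) ∧
    t.1.points ∩ t.2.1.points = {C} ∧ t.2.1.points ∩ t.2.2.points = {B}}

/-- The point with abscissa `x` on the line `X + Y = c`. -/
def onLine (c x : ℤ) : Pt := (x, c - x)

/-- The binomial coefficient of two integers, equal to `0` unless `0 ≤ b ≤ a`. -/
def binom (a b : ℤ) : ℕ := if 0 ≤ b ∧ b ≤ a then a.toNat.choose b.toNat else 0

/-- The entries `f_1, …, f_N` of an `N`-tuple, numbered from `1`. -/
def entry {N : ℕ} (f : Fin N → ℤ) (t : ℕ) : ℤ :=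
  if h : 1 ≤ t ∧ t ≤ N then f ⟨t - 1, by omega⟩ else 0

/-- The tuples `(n_1, …, n_{2r-1})` of positive integers with sum `g`, such that the entries with
odd index have sum `d` and those with even index have sum `g - d`. -/
noncomputable def blockTuples (r : ℕ) (g d : ℤ) : Finset (Fin (2 * r - 1) → ℤ) :=
  {ν ∈ Fintype.piFinset (fun _ : Fin (2 * r - 1) => Finset.Icc 1 g) |
    ∑ t ∈ Finset.Icc 1 (2 * r - 1), entry ν t = g ∧
    ∑ t ∈ Finset.Icc 1 r, entry ν (2 * t - 1) = d ∧
    ∑ t ∈ Finset.Icc 1 (r - 1), entry ν (2 * t) = g - d}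

/-- The conditions on `(s_1, t_2, s_3, t_4, …, s_{2r-3}, t_{2r-2})`, which are the entries of `σ`
in this order, for the blocks `(n_1, …, n_{2r-1})`, which are the entries of `ν`. Here `δ` stands
for `l_1 - l_2` and `x` for `n_{2l+1}''`, so that `n_{2l+1}' = n_{2l+1} - x ≥ 0`. -/
def OffsetCond (r : ℕ) (δ : ℤ) (ν : Fin (2 * r - 1) → ℤ) (σ : Fin (2 * r - 2) → ℤ) : Prop :=
  ∃ l ∈ Finset.range r, ∃ x ∈ Finset.Icc 1 (entry ν (2 * l + 1)),
    δ = x + ∑ e ∈ Finset.Icc (l + 1) (r - 1), entry ν (2 * e + 1) ∧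
    (∀ t ∈ Finset.Icc 1 (2 * l), entry σ t ∈ Finset.Icc 1 (δ - 1)) ∧
    (l + 1 < r → entry σ (2 * l + 1) ∈ Finset.Icc 1 (δ - x) ∧
      entry σ (2 * l + 2) ∈ Finset.Icc 1 (δ - x)) ∧
    (∀ s ∈ Finset.range (2 * r), Odd s → 3 ≤ s → 2 * l + s + 3 ≤ 2 * r →
      entry σ (2 * l + s) ∈
        Finset.Icc 1 (δ - x - ∑ e ∈ Finset.Icc 1 ((s - 1) / 2), entry ν (2 * l + 2 * e + 1)) ∧
      entry σ (2 * l + s + 1) ∈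
        Finset.Icc 1 (δ - x - ∑ e ∈ Finset.Icc 1 ((s - 1) / 2), entry ν (2 * l + 2 * e + 1)))

noncomputable instance (r : ℕ) (δ : ℤ) (ν : Fin (2 * r - 1) → ℤ) :
    DecidablePred (OffsetCond r δ ν) := fun σ => by
  unfold OffsetCond
  infer_instance

/-- The tuples `(s_1, t_2, …, s_{2r-3}, t_{2r-2})` satisfying the conditions above; every entry of
such a tuple lies between `1` and `δ - 1`. -/
noncomputable def offsetTuples (r : ℕ) (δ : ℤ) (ν : Fin (2 * r - 1) → ℤ) : Finset (Fin (2 * r - 2) → ℤ) :=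
  {σ ∈ Fintype.piFinset (fun _ : Fin (2 * r - 2) => Finset.Icc 1 (δ - 1)) | OffsetCond r δ ν σ}

/-- The triple sum for `_{A_{l2}} N_{A_{l1}}^{A_k}` when `A_k` lies above the level of `A_{l2}`;
`g` is the overlap length. -/
noncomputable def tripleSum (g l₁ l₂ k : ℤ) : ℕ :=
  ∑ r ∈ Finset.Icc 2 ((g + 1) / 2).toNat,
    ∑ ν ∈ blockTuples r g (k - l₂),
      ∑ σ ∈ offsetTuples r (l₁ - l₂) ν,
        binom (entry ν 1 - 1) (l₂ - l₁ + entry ν 1 + entry σ 1) *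
        binom (entry ν 2) (entry σ 2 - entry σ 1) *
        binom (entry ν (2 * r - 1) - 1) (entry ν (2 * r - 1) - entry σ (2 * r - 2)) *
        ∏ e ∈ Finset.Icc 2 (r - 1),
          (binom (entry ν (2 * e - 1))
            (entry ν (2 * e - 1) + entry σ (2 * e - 1) - entry σ (2 * e - 2)) *
          binom (entry ν (2 * e)) (entry σ (2 * e) - entry σ (2 * e - 1)))

/-- The sum over `l_2`, `l_1`, `k` and `m` for fixed `n`, `i` and `j`, with `k' = k + l_1 - l_2`. -/
noncomputable def pathSum (n i j : ℤ) : ℕ :=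
  ∑ l₂ ∈ Finset.Icc 0 (n - i - 2), ∑ l₁ ∈ Finset.Icc (l₂ + 2) (n - i),
    ∑ k ∈ Finset.Icc l₁ (i + j - n + l₂), ∑ m ∈ Finset.Icc (k + l₁ - l₂) (n - j + k),
      numDiverging (0, 0) (onLine (n - i) l₁) (onLine (n - i) l₂) *
      numTriples (onLine (n - i) l₂) (onLine (n - i) l₁) (onLine j k) *
      numConverging (onLine j k) (onLine j (k + l₁ - l₂)) (onLine n m)

end MAB

/-! Let `w` be the reversal of `v`, and let d(t) be the number of letters `a` in the prefix of
length t of `u` minus that of `w`. An external border of length t is a zero of d at t; an internal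
border of length t says d(n - t) = d(n). Hence j is the first positive zero of d, n - i is the last
time before n at which d takes its final value, and the overlap is g = j - (n - i)
(`ncard_mabPairs_fiber`).

Put a = n - i and c = n - j, so that n = a + g + c, and cut both words at times a and a + g.
Exchanging `u` and `w` gives the factor 2, so let δ = d(a) = d(n) = l₁ - l₂ be positive. Before a
the two paths from the origin do not meet again: a diverging pair. On the last c steps d climbs from
0 to δ and equals δ only at the end: after a shift of `w` by δ, which moves its start to A_{k'}, a
converging pair. On the middle g steps d goes from δ to 0, avoids δ after the start and 0 before the
end: a triple of paths. The three pieces are independent once l₂, l₁, k, m are fixed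
(`ncard_upperWords_fiber`).

Converging pairs satisfy a four-term recursion on first letters, solved by the ballot-type product
in `mul_ncard_convergingWords`; diverging pairs are their reversals.

In the middle piece d changes by at most 1 per step, so it must drop to δ - 1 at once and then stay
strictly between 0 and δ until it ends at 0 (`ncard_confinedWords`). Cut the word of `w` there into
maximal runs. Along a run of `a` the height d never rises, along a run of `b` it never falls, so the
strip only constrains the heights at the ends of runs, and a run with given end heights contributes
one binomial coefficient (`walkCount_eq_sum_blockSum`). The extra inequalities defining the set C
discard only vanishing terms: from a given height the walk cannot come down to 0 with fewer letters
`a` than that height (`offsetCond_of_runWeight_ne_zero`). -/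

namespace MAB

/-! ### Letter counts and discrete continuity -/

/-- The number of letters `a` of a word. -/
def cnt (w : Word) : ℤ := (w.count true : ℤ)

@[simp] theorem cnt_nil : cnt [] = 0 := rfl

@[simp] theorem cnt_cons (c : Letter) (w : Word) :
    cnt (c :: w) = (if c then 1 else 0) + cnt w := by
  cases c <;> simp [cnt, add_comm]

@[simp] theorem cnt_append (u v : Word) : cnt (u ++ v) = cnt u + cnt v := by
  simp [cnt]

@[simp] theorem cnt_reverse (u : Word) : cnt u.reverse = cnt u := by
  simp [cnt]

theorem cnt_nonneg (w : Word) : 0 ≤ cnt w := by simp [cnt]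

theorem cnt_le_length (w : Word) : cnt w ≤ w.length := by
  simpa [cnt] using List.count_le_length

theorem count_false (w : Word) : (w.count false : ℤ) = w.length - cnt w := by
  induction w with
  | nil => simp
  | cons c w ih => cases c <;> simp [ih] <;> ring

theorem cnt_take_add_drop (t : ℕ) (w : Word) : cnt (w.take t) + cnt (w.drop t) = cnt w := by
  rw [← cnt_append, List.take_append_drop]

theorem cnt_take_succ_sub (w : Word) (t : ℕ) :
    0 ≤ cnt (w.take (t + 1)) - cnt (w.take t) ∧ cnt (w.take (t + 1)) - cnt (w.take t) ≤ 1 := by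
  induction w generalizing t with
  | nil => simp
  | cons c w ih =>
    cases t with
    | zero => cases c <;> simp
    | succ t => simpa using ih t

/-- An integer sequence with steps of size at most one which avoids `c` stays above `c`. -/
theorem stays_above {f : ℕ → ℤ} {c : ℤ} (hf : ∀ t, f t - 1 ≤ f (t + 1)) {s e : ℕ}
    (hs : c < f s) (hne : ∀ t, s ≤ t → t ≤ e → f t ≠ c) {t : ℕ} (h1 : s ≤ t) (h2 : t ≤ e) :
    c < f t := by
  induction t, h1 using Nat.le_induction with
  | base => exact hs
  | succ t h ih =>
    have := ih (by omega)
    have := hf t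
    have := hne (t + 1) (by omega) h2
    omega

/-- The upper version of `stays_above`. -/
theorem stays_below {f : ℕ → ℤ} {c : ℤ} (hf : ∀ t, f (t + 1) ≤ f t + 1) {s e : ℕ}
    (hs : f s < c) (hne : ∀ t, s ≤ t → t ≤ e → f t ≠ c) {t : ℕ} (h1 : s ≤ t) (h2 : t ≤ e) :
    f t < c := by
  have := stays_above (f := fun t => - f t) (c := -c) (fun t => by have := hf t; omega)
    (by omega : -c < - f s) (fun t a b => by have := hne t a b; omega) h1 h2
  omega

/-! ### Lattice paths as words -/

theorem foldl_step (A : Pt) (w : Word) :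
    w.foldl step A = (A.1 + cnt w, A.2 + (w.length - cnt w)) := by
  induction w generalizing A with
  | nil => simp
  | cons c w ih =>
    rw [List.foldl_cons, ih]
    cases c <;> ext <;> simp [step] <;> ring

theorem mem_visited {A X : Pt} {w : Word} :
    X ∈ visited A w ↔ ∃ t ≤ w.length, X = (A.1 + cnt (w.take t), A.2 + (t - cnt (w.take t))) := by
  induction w generalizing A with
  | nil => simp [visited]
  | cons c w ih =>
    rw [visited, Set.mem_insert_iff, ih]
    constructor
    · rintro (rfl | ⟨t, ht, rfl⟩)
      · exact ⟨0, by simp, by simp⟩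
      · refine ⟨t + 1, by simpa using ht, ?_⟩
        cases c <;> ext <;> simp [step] <;> ring
    · rintro ⟨t, ht, rfl⟩
      cases t with
      | zero => left; simp
      | succ t =>
        right
        refine ⟨t, by simpa using ht, ?_⟩
        cases c <;> ext <;> simp [step] <;> ring

/-- Two paths of the same length from the same antidiagonal that meet at time `s` meet only there
iff their abscissas differ at all other times. -/
theorem visited_inter_eq_singleton {A B X : Pt} {p q : Word} (hAB : A.1 + A.2 = B.1 + B.2) {N s : ℕ}
    (hp : p.length = N) (hq : q.length = N) (hs : s ≤ N)
    (hX : X = (A.1 + cnt (p.take s), A.2 + (s - cnt (p.take s))))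
    (hpq : A.1 + cnt (p.take s) = B.1 + cnt (q.take s)) :
    visited A p ∩ visited B q = {X} ↔
      ∀ t ≤ N, t ≠ s → A.1 + cnt (p.take t) ≠ B.1 + cnt (q.take t) := by
  constructor
  · intro h t ht hts he
    have : (A.1 + cnt (p.take t), A.2 + (t - cnt (p.take t))) ∈ visited A p ∩ visited B q := by
      refine ⟨mem_visited.2 ⟨t, by omega, rfl⟩, mem_visited.2 ⟨t, by omega, ?_⟩⟩
      ext <;> simp <;> omega
    rw [h, hX, Set.mem_singleton_iff, Prod.mk.injEq] at this
    omega
  · intro h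
    ext Y
    rw [Set.mem_singleton_iff]
    constructor
    · rintro ⟨h1, h2⟩
      obtain ⟨t, ht, rfl⟩ := mem_visited.1 h1
      obtain ⟨t', ht', he⟩ := mem_visited.1 h2
      rw [Prod.mk.injEq] at he
      -- The sum of the coordinates grows by one per step from a common value, so paths can share a
      -- point only at equal times.
      obtain rfl : t = t' := by omega
      by_cases hts : t = s
      · rw [hX, hts]
      · exact absurd he.1 (h t (by omega) hts)
    · rintro rfl
      refine ⟨mem_visited.2 ⟨s, by omega, hX⟩, mem_visited.2 ⟨s, by omega, ?_⟩⟩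
      rw [hX]
      ext <;> simp <;> omega

/-- Pairs of words of length `N` with `x` and `y` letters `a` whose prefixes of the same positive
length never have the same number of letters `a`. -/
def divergingWords (N : ℕ) (x y : ℤ) : Set (Word × Word) :=
  {w | w.1.length = N ∧ w.2.length = N ∧ cnt w.1 = x ∧ cnt w.2 = y ∧
    ∀ t ≤ N, t ≠ 0 → cnt (w.1.take t) ≠ cnt (w.2.take t)}

/-- Pairs of words of length `N` with `x` and `y` letters `a` whose suffixes of the same positive
length never have the same number of letters `a`. -/
def convergingWords (N : ℕ) (x y : ℤ) : Set (Word × Word) :=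
  {w | w.1.length = N ∧ w.2.length = N ∧ cnt w.1 = x ∧ cnt w.2 = y ∧
    ∀ t ≤ N, t ≠ N → cnt (w.1.take t) ≠ x - y + cnt (w.2.take t)}

/-- Pairs of words of length `N` with `x` and `y` letters `a` which satisfy the conditions for both
prefixes and suffixes. -/
def confinedWords (N : ℕ) (x y : ℤ) : Set (Word × Word) :=
  {w | w.1.length = N ∧ w.2.length = N ∧ cnt w.1 = x ∧ cnt w.2 = y ∧
    (∀ t ≤ N, t ≠ N → cnt (w.1.take t) ≠ x - y + cnt (w.2.take t)) ∧
    ∀ t ≤ N, t ≠ 0 → cnt (w.2.take t) ≠ cnt (w.1.take t)}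

theorem isFromTo_iff {p : LatticePath} {A B : Pt} {N : ℕ} (h : B.1 + B.2 = A.1 + A.2 + N) :
    p.IsFromTo A B ↔ p.start = A ∧ p.word.length = N ∧ cnt p.word = B.1 - A.1 := by
  rw [LatticePath.IsFromTo, LatticePath.finish, foldl_step]
  constructor
  · rintro ⟨rfl, rfl⟩
    simp only at h
    refine ⟨rfl, ?_, ?_⟩
    · omega
    · simp
  · rintro ⟨rfl, h1, h2⟩
    refine ⟨rfl, ?_⟩
    ext <;> simp only <;> omega

theorem numDiverging_eq {A B C : Pt} {N : ℕ} (hB : B.1 + B.2 = A.1 + A.2 + N)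
    (hC : C.1 + C.2 = A.1 + A.2 + N) :
    numDiverging A B C = (divergingWords N (B.1 - A.1) (C.1 - A.1)).ncard := by
  have hinj : Function.Injective (fun w : Word × Word =>
      ((⟨A, w.1⟩, ⟨A, w.2⟩) : LatticePath × LatticePath)) := by
    rintro ⟨p, q⟩ ⟨p', q'⟩ h
    simpa [LatticePath.ext_iff] using h
  rw [numDiverging, ← Set.ncard_image_of_injective _ hinj]
  congr 1
  ext ⟨⟨P, p⟩, ⟨Q, q⟩⟩
  simp only [Set.mem_ofPred_eq, isFromTo_iff hB, isFromTo_iff hC, LatticePath.points, Set.mem_image,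
    divergingWords, Prod.exists, Prod.mk.injEq, LatticePath.mk.injEq]
  constructor
  · rintro ⟨⟨rfl, h1, h2⟩, ⟨rfl, h3, h4⟩, h5⟩
    rw [visited_inter_eq_singleton rfl h1 h3 (Nat.zero_le N) (by simp) (by simp)] at h5
    exact ⟨p, q, ⟨h1, h3, h2, h4, fun t ht h0 he => h5 t ht h0 (by rw [he])⟩,
      ⟨rfl, rfl⟩, rfl, rfl⟩
  · rintro ⟨p, q, ⟨h1, h3, h2, h4, h5⟩, ⟨rfl, rfl⟩, rfl, rfl⟩
    refine ⟨⟨rfl, h1, h2⟩, ⟨rfl, h3, h4⟩, ?_⟩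
    rw [visited_inter_eq_singleton rfl h1 h3 (Nat.zero_le N) (by simp) (by simp)]
    exact fun t ht h0 he => h5 t ht h0 (by linarith)

theorem visited_inter_eq_finish {A B C : Pt} {N : ℕ} (hA : C.1 + C.2 = A.1 + A.2 + N)
    (hB : C.1 + C.2 = B.1 + B.2 + N) {p q : Word} (hp : p.length = N) (hq : q.length = N)
    (h1 : cnt p = C.1 - A.1) (h2 : cnt q = C.1 - B.1) :
    visited A p ∩ visited B q = {C} ↔
      ∀ t ≤ N, t ≠ N → cnt (p.take t) ≠ B.1 - A.1 + cnt (q.take t) := by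
  have e1 : p.take N = p := by rw [← hp, List.take_length]
  have e2 : q.take N = q := by rw [← hq, List.take_length]
  rw [visited_inter_eq_singleton (by omega) hp hq le_rfl
    (by rw [e1]; ext <;> simp <;> omega) (by rw [e1, e2]; omega)]
  refine forall₃_congr fun t _ _ => ?_
  constructor <;> intro h h' <;> apply h <;> linarith

theorem numConverging_eq {A B C : Pt} {N : ℕ} (hA : C.1 + C.2 = A.1 + A.2 + N)
    (hB : C.1 + C.2 = B.1 + B.2 + N) :
    numConverging A B C = (convergingWords N (C.1 - A.1) (C.1 - B.1)).ncard := by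
  have hinj : Function.Injective (fun w : Word × Word =>
      ((⟨A, w.1⟩, ⟨B, w.2⟩) : LatticePath × LatticePath)) := by
    rintro ⟨p, q⟩ ⟨p', q'⟩ h
    simpa [LatticePath.ext_iff] using h
  rw [numConverging, ← Set.ncard_image_of_injective _ hinj]
  congr 1
  ext ⟨⟨P, p⟩, ⟨Q, q⟩⟩
  have hd : C.1 - A.1 - (C.1 - B.1) = B.1 - A.1 := by ring
  simp only [Set.mem_ofPred_eq, isFromTo_iff hA, isFromTo_iff hB, LatticePath.points, Set.mem_image,
    convergingWords, Prod.exists, Prod.mk.injEq, LatticePath.mk.injEq, hd]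
  constructor
  · rintro ⟨⟨rfl, h1, h2⟩, ⟨rfl, h3, h4⟩, h5⟩
    rw [visited_inter_eq_finish hA hB h1 h3 h2 h4] at h5
    exact ⟨p, q, ⟨h1, h3, h2, h4, h5⟩, ⟨rfl, rfl⟩, rfl, rfl⟩
  · rintro ⟨p, q, ⟨h1, h3, h2, h4, h5⟩, ⟨rfl, rfl⟩, rfl, rfl⟩
    refine ⟨⟨rfl, h1, h2⟩, ⟨rfl, h3, h4⟩, ?_⟩
    rwa [visited_inter_eq_finish hA hB h1 h3 h2 h4]

/-- The third path carries no new data: it repeats the first word from `B`. Its condition compares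
the same two words read from a common start, where the first condition compares them with a shift.
-/
theorem numTriples_eq {A B C : Pt} {N : ℕ} (hA : C.1 + C.2 = A.1 + A.2 + N)
    (hB : C.1 + C.2 = B.1 + B.2 + N) :
    numTriples A B C = (confinedWords N (C.1 - A.1) (C.1 - B.1)).ncard := by
  have hinj : Function.Injective (fun w : Word × Word =>
      ((⟨A, w.1⟩, ⟨B, w.2⟩, ⟨B, w.1⟩) : LatticePath × LatticePath × LatticePath)) := by
    rintro ⟨p, q⟩ ⟨p', q'⟩ h
    simp [LatticePath.ext_iff] at h
    simp [h.1, h.2.1]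
  rw [numTriples, ← Set.ncard_image_of_injective _ hinj]
  congr 1
  ext ⟨⟨P, p⟩, ⟨Q, q⟩, ⟨P', p'⟩⟩
  have hd : C.1 - A.1 - (C.1 - B.1) = B.1 - A.1 := by ring
  simp only [Set.mem_ofPred_eq, isFromTo_iff hA, isFromTo_iff hB, LatticePath.points, Set.mem_image,
    confinedWords, Prod.exists, Prod.mk.injEq, LatticePath.mk.injEq, hd]
  constructor
  · rintro ⟨⟨rfl, h1, h2⟩, ⟨rfl, h3, h4⟩, ⟨rfl, rfl⟩, h5, h6⟩
    rw [visited_inter_eq_finish hA hB h1 h3 h2 h4] at h5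
    rw [visited_inter_eq_singleton rfl h3 h1 (Nat.zero_le N) (by simp) (by simp)] at h6
    exact ⟨p', q, ⟨h1, h3, h2, h4, h5, fun t ht h0 he => h6 t ht h0 (by rw [he])⟩,
      ⟨rfl, rfl⟩, ⟨rfl, rfl⟩, rfl, rfl⟩
  · rintro ⟨p, q, ⟨h1, h3, h2, h4, h5, h6⟩, ⟨rfl, rfl⟩, ⟨rfl, rfl⟩, rfl, rfl⟩
    refine ⟨⟨rfl, h1, h2⟩, ⟨rfl, h3, h4⟩, ⟨rfl, rfl⟩, ?_, ?_⟩
    · rwa [visited_inter_eq_finish hA hB h1 h3 h2 h4]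
    · rw [visited_inter_eq_singleton rfl h3 h1 (Nat.zero_le N) (by simp) (by simp)]
      exact fun t ht h0 he => h6 t ht h0 (by linarith)

/-! ### Binomial coefficients of integers -/

theorem binom_natCast (n k : ℕ) : binom n k = n.choose k := by
  unfold binom
  split_ifs with h
  · simp
  · rw [Nat.choose_eq_zero_of_lt (by omega)]

theorem binom_of_neg {a b : ℤ} (h : b < 0) : binom a b = 0 := by
  unfold binom
  rw [if_neg (by omega)]

theorem binom_of_lt {a b : ℤ} (h : a < b) : binom a b = 0 := by
  unfold binom
  rw [if_neg (by omega)]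

theorem binom_ne_zero {a b : ℤ} (h : binom a b ≠ 0) : 0 ≤ b ∧ b ≤ a := by
  unfold binom at h
  split_ifs at h with h'
  · exact h'
  · exact absurd rfl h

theorem binom_zero_left (z : ℤ) : binom 0 z = if z = 0 then 1 else 0 := by
  unfold binom
  split_ifs with h1 h2 h2
  · subst h2; simp
  · omega
  · omega
  · rfl

theorem binom_symm {a b : ℤ} : binom a (a - b) = binom a b := by
  unfold binom
  by_cases h : 0 ≤ b ∧ b ≤ a
  · rw [if_pos h, if_pos (by omega), show (a - b).toNat = a.toNat - b.toNat by omega,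
      Nat.choose_symm (by omega)]
  · rw [if_neg h, if_neg (by omega)]

/-- Pascal's rule needs no boundary cases in `z`, thanks to the zero convention. It does fail at n =
-1, z = 0, whence the sign condition and the care with arguments such as n - 1 later. -/
theorem binom_succ {n : ℤ} (hn : 0 ≤ n) (z : ℤ) :
    binom (n + 1) z = binom n z + binom n (z - 1) := by
  lift n to ℕ using hn
  obtain hz | rfl | hz := lt_trichotomy z 0
  · rw [binom_of_neg hz, binom_of_neg hz, binom_of_neg (by omega)]
  · rw [binom_of_neg (b := 0 - 1) (by omega)]
    have := binom_natCast n 0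
    have := binom_natCast (n + 1) 0
    simp_all
  · obtain ⟨k, rfl⟩ : ∃ k : ℕ, z = (k + 1 : ℕ) := ⟨(z - 1).toNat, by omega⟩
    rw [show ((k + 1 : ℕ) : ℤ) - 1 = (k : ℕ) by push_cast; ring, binom_natCast, binom_natCast,
      show (n : ℤ) + 1 = (n + 1 : ℕ) by push_cast; ring, binom_natCast, Nat.choose_succ_succ,
      add_comm]

theorem mul_binom_succ {n : ℤ} (hn : 0 ≤ n) (z : ℤ) :
    z * binom (n + 1) z = (n + 1) * binom n (z - 1) := by
  lift n to ℕ using hn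
  obtain hz | rfl | hz := lt_trichotomy z 0
  · rw [binom_of_neg hz, binom_of_neg (by omega)]; simp
  · rw [binom_of_neg (b := 0 - 1) (by omega)]; simp
  · obtain ⟨k, rfl⟩ : ∃ k : ℕ, z = (k + 1 : ℕ) := ⟨(z - 1).toNat, by omega⟩
    rw [show ((k + 1 : ℕ) : ℤ) - 1 = (k : ℕ) by push_cast; ring, binom_natCast,
      show (n : ℤ) + 1 = (n + 1 : ℕ) by push_cast; ring, binom_natCast]
    have := Nat.add_one_mul_choose_eq n k
    push_cast
    exact_mod_cast by linarith

/-! ### Cardinalities of sets of pairs of words -/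

theorem ncard_eq_sum_fiber {α β : Type*} [DecidableEq β] {S : Set α} (hS : S.Finite) (I : Finset β)
    (f : α → β) (h : ∀ x ∈ S, f x ∈ I) : S.ncard = ∑ y ∈ I, {x ∈ S | f x = y}.ncard := by
  lift S to Finset α using hS
  rw [Set.ncard_coe_finset, Finset.card_eq_sum_card_fiberwise (f := f) (t := I) (fun x hx => h x hx)]
  refine Finset.sum_congr rfl fun y _ => ?_
  rw [← Set.ncard_coe_finset]
  congr 1
  ext x
  simp

theorem finite_of_length {S : Set (Word × Word)} (N : ℕ)
    (h : ∀ w ∈ S, w.1.length = N ∧ w.2.length = N) : S.Finite :=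
  ((List.finite_length_eq Letter N).prod (List.finite_length_eq Letter N)).subset
    fun w hw => ⟨(h w hw).1, (h w hw).2⟩

/-- Counting pairs of words by their first letters. -/
theorem ncard_eq_sum_cons {S : Set (Word × Word)} (N : ℕ)
    (h : ∀ w ∈ S, w.1.length = N + 1 ∧ w.2.length = N + 1) :
    S.ncard = {w : Word × Word | (true :: w.1, true :: w.2) ∈ S}.ncard +
      {w : Word × Word | (true :: w.1, false :: w.2) ∈ S}.ncard +
      ({w : Word × Word | (false :: w.1, true :: w.2) ∈ S}.ncard +
      {w : Word × Word | (false :: w.1, false :: w.2) ∈ S}.ncard) := by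
  have key (c c' : Letter) :
      {w ∈ S | ((w.1.headD true, w.2.headD true) : Letter × Letter) = (c, c')}.ncard =
        {w : Word × Word | (c :: w.1, c' :: w.2) ∈ S}.ncard := by
    have hinj : Function.Injective (fun w : Word × Word => (c :: w.1, c' :: w.2)) := by
      rintro ⟨p, q⟩ ⟨p', q'⟩ h
      simpa using h
    rw [← Set.ncard_image_of_injective {w : Word × Word | (c :: w.1, c' :: w.2) ∈ S} hinj]
    congr 1
    ext ⟨p, q⟩
    constructor
    · rintro ⟨hS, he⟩
      obtain ⟨l1, l2⟩ := h _ hS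
      match p, q, l1, l2 with
      | x :: p, y :: q, _, _ =>
        simp only [List.headD_cons, Prod.mk.injEq] at he
        obtain ⟨rfl, rfl⟩ := he
        exact ⟨(p, q), hS, rfl⟩
    · rintro ⟨w, hS, he⟩
      rw [← he]
      exact ⟨hS, rfl⟩
  rw [ncard_eq_sum_fiber (finite_of_length _ h) Finset.univ
    (fun w => ((w.1.headD true, w.2.headD true) : Letter × Letter)) (fun _ _ => Finset.mem_univ _),
    Fintype.sum_prod_type]
  simp only [key, Fintype.sum_bool]

/-! ### Converging and diverging pairs -/

/-- The condition at time 0 is exactly x ≠ y; all the others pass to the tails, with the counts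
reduced by the removed letters. -/
theorem convergingWords_cons {N : ℕ} {x y : ℤ} (hxy : x ≠ y) (c c' : Letter) :
    {w : Word × Word | (c :: w.1, c' :: w.2) ∈ convergingWords (N + 1) x y} =
      convergingWords N (x - if c then 1 else 0) (y - if c' then 1 else 0) := by
  ext ⟨p, q⟩
  simp only [convergingWords, Set.mem_ofPred_eq, List.length_cons, Nat.add_right_cancel_iff,
    cnt_cons]
  refine and_congr Iff.rfl (and_congr Iff.rfl (and_congr (by omega) (and_congr (by omega) ?_)))
  constructor
  · intro h t ht hN he
    apply h (t + 1) (by omega) (by omega)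
    simp only [List.take_succ_cons, cnt_cons]
    omega
  · intro h t ht hN he
    cases t with
    | zero => simp at he; omega
    | succ t =>
      apply h t (by omega) (by omega)
      simp only [List.take_succ_cons, cnt_cons] at he
      omega

theorem ncard_convergingWords_self {N : ℕ} (hN : N ≠ 0) (x : ℤ) :
    (convergingWords N x x).ncard = 0 := by
  rw [show convergingWords N x x = ∅ by
    refine Set.eq_empty_of_forall_notMem fun w hw => ?_
    exact hw.2.2.2.2 0 (Nat.zero_le _) hN.symm (by simp), Set.ncard_empty]

theorem ncard_convergingWords_zero (x y : ℤ) :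
    (convergingWords 0 x y).ncard = if x = 0 ∧ y = 0 then 1 else 0 := by
  split_ifs with h
  · obtain ⟨rfl, rfl⟩ := h
    rw [show convergingWords 0 0 0 = {([], [])} by
      ext ⟨p, q⟩
      simp only [convergingWords, Set.mem_ofPred_eq, List.length_eq_zero_iff,
        Set.mem_singleton_iff, Prod.mk.injEq]
      constructor
      · exact fun h => ⟨h.1, h.2.1⟩
      · rintro ⟨rfl, rfl⟩
        exact ⟨rfl, rfl, rfl, rfl, fun t ht h0 => absurd (Nat.le_zero.1 ht) h0⟩,
      Set.ncard_singleton]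
  · rw [show convergingWords 0 x y = ∅ by
      refine Set.eq_empty_of_forall_notMem ?_
      rintro ⟨p, q⟩ ⟨h1, h2, h3, h4, -⟩
      rw [List.length_eq_zero_iff] at h1 h2
      dsimp only at h1 h2
      subst h1 h2
      exact h ⟨h3.symm, h4.symm⟩, Set.ncard_empty]

theorem ncard_convergingWords_succ {N : ℕ} {x y : ℤ} (hxy : x ≠ y) :
    (convergingWords (N + 1) x y).ncard =
      (convergingWords N (x - 1) (y - 1)).ncard + (convergingWords N (x - 1) y).ncard +
      ((convergingWords N x (y - 1)).ncard + (convergingWords N x y).ncard) := by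
  rw [ncard_eq_sum_cons N fun w hw => ⟨hw.1, hw.2.1⟩]
  simp [convergingWords_cons hxy]

/-- Both sides vanish on the diagonal x = y and satisfy the same recursion off it. The induction
starts at 1 because its step cancels a factor `N`. -/
theorem mul_ncard_convergingWords {N : ℕ} (hN : 1 ≤ N) {x y : ℤ} (hxy : y ≤ x) :
    (N : ℤ) * (convergingWords N x y).ncard = (x - y) * binom N x * binom N y := by
  induction N, hN using Nat.le_induction generalizing x y with
  | base =>
    obtain rfl | hxy := hxy.eq_or_lt
    · simp [ncard_convergingWords_self]
    rw [ncard_convergingWords_succ hxy.ne']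
    simp only [ncard_convergingWords_zero]
    have h1 := binom_succ le_rfl x
    have h2 := binom_succ le_rfl y
    simp only [binom_zero_left, zero_add] at h1 h2
    rw [Nat.cast_one, h1, h2]
    split_ifs <;> simp <;> omega
  | succ N hN ih =>
    obtain rfl | hxy := hxy.eq_or_lt
    · simp [ncard_convergingWords_self]
    rw [ncard_convergingWords_succ hxy.ne']
    have i1 := ih (x := x - 1) (y := y - 1) (by omega)
    have i2 := ih (x := x - 1) (y := y) (by omega)
    have i3 := ih (x := x) (y := y - 1) (by omega)
    have i4 := ih (x := x) (y := y) (by omega)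
    have b1 := mul_binom_succ (Int.natCast_nonneg N) x
    have b2 := mul_binom_succ (Int.natCast_nonneg N) y
    push_cast [binom_succ (Int.natCast_nonneg N)] at b1 b2 ⊢
    have hN0 : (N : ℤ) ≠ 0 := by positivity
    apply mul_left_cancel₀ hN0
    -- After Pascal's rule only products of binomials in row `N` remain; the absorption identities
    -- `b1` and `b2` account for the mismatch of the linear factors.
    linear_combination (N + 1 : ℤ) * (i1 + i2 + i3 + i4) +
      ((binom N y : ℤ) + binom N (y - 1)) * b1 - ((binom N x : ℤ) + binom N (x - 1)) * b2

theorem ncard_divergingWords (N : ℕ) (x y : ℤ) :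
    (divergingWords N x y).ncard = (convergingWords N x y).ncard := by
  have hinj : Function.Injective (fun w : Word × Word => (w.1.reverse, w.2.reverse)) := by
    rintro ⟨p, q⟩ ⟨p', q'⟩ h
    simpa using h
  rw [← Set.ncard_image_of_injective _ hinj]
  congr 1
  have take_rev (w : Word) (hw : w.length = N) (t : ℕ) (ht : t ≤ N) :
      cnt (w.reverse.take t) = cnt w - cnt (w.take (N - t)) := by
    rw [List.take_reverse, cnt_reverse, hw]
    linarith [cnt_take_add_drop (N - t) w]
  ext ⟨p, q⟩
  simp only [Set.mem_image, Prod.exists, Prod.mk.injEq, divergingWords, convergingWords,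
    Set.mem_ofPred_eq]
  constructor
  · rintro ⟨p, q, ⟨h1, h2, rfl, rfl, h⟩, rfl, rfl⟩
    refine ⟨by simpa, by simpa, by simp, by simp, fun t ht hN he => ?_⟩
    rw [take_rev p h1 t ht, take_rev q h2 t ht] at he
    exact h (N - t) (by omega) (by omega) (by linarith)
  · rintro ⟨h1, h2, rfl, rfl, h⟩
    refine ⟨p.reverse, q.reverse, ⟨by simpa, by simpa, by simp, by simp, fun t ht hN he => ?_⟩,
      by simp, by simp⟩
    rw [take_rev p h1 t ht, take_rev q h2 t ht] at he
    exact h (N - t) (by omega) (by omega) (by linarith)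

/-! ### Confined walks -/

/-- The difference of two words walks from the height `y` to its end at height `0` and stays
strictly between `0` and `δ` before. -/
def IsWalk (δ : ℤ) : ℤ → Word → Word → Prop
  | y, [], [] => y = 0
  | y, c :: p, c' :: q =>
    (0 < y ∧ y < δ) ∧ IsWalk δ (y - (if c then 1 else 0) + if c' then 1 else 0) p q
  | _, [], _ :: _ => False
  | _, _ :: _, [] => False

theorem isWalk_iff {δ y : ℤ} {p q : Word} : IsWalk δ y p q ↔
    p.length = q.length ∧ cnt p = y + cnt q ∧ ∀ t < p.length,
      0 < y - cnt (p.take t) + cnt (q.take t) ∧ y - cnt (p.take t) + cnt (q.take t) < δ := by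
  induction p generalizing y q with
  | nil => cases q <;> simp [IsWalk, eq_comm]
  | cons c p ih =>
    cases q with
    | nil => simp [IsWalk]
    | cons c' q =>
      rw [IsWalk, ih]
      simp only [List.length_cons, Nat.add_right_cancel_iff, cnt_cons]
      constructor
      · rintro ⟨h0, h1, h2, h3⟩
        refine ⟨h1, by linarith, fun t ht => ?_⟩
        cases t with
        | zero => simpa using h0
        | succ t =>
          have := h3 t (by omega)
          simp only [List.take_succ_cons, cnt_cons]
          constructor <;> linarith
      · rintro ⟨h1, h2, h3⟩
        refine ⟨by simpa using h3 0 (by omega), h1, by linarith, fun t ht => ?_⟩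
        have := h3 (t + 1) (by omega)
        simp only [List.take_succ_cons, cnt_cons] at this
        constructor <;> linarith

/-- The pairs of words whose difference is a walk from `y`, the first word with `d` letters `a` and
`e` letters `b`. -/
def walkWords (δ y d e : ℤ) : Set (Word × Word) :=
  {w | w.1.length = d + e ∧ w.2.length = w.1.length ∧ cnt w.1 = d ∧ IsWalk δ y w.1 w.2}

/-- The number of walks. -/
noncomputable def walkCount (δ y d e : ℤ) : ℕ := (walkWords δ y d e).ncard

theorem walkCount_eq_zero {δ y d e : ℤ} (h : d < 0 ∨ e < 0 ∨ (0 < d + e ∧ ¬ (0 < y ∧ y < δ))) :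
    walkCount δ y d e = 0 := by
  rw [walkCount, show walkWords δ y d e = ∅ by
    refine Set.eq_empty_of_forall_notMem ?_
    rintro ⟨p, q⟩ ⟨h1, h2, h3, h4⟩
    dsimp only at *
    have := cnt_nonneg p
    have := cnt_le_length p
    rcases h with h | h | ⟨h, h'⟩
    · omega
    · omega
    · match p, q, h4 with
      | [], [], _ => simp at h1; omega
      | c :: p, c' :: q, h4 => exact h' h4.1, Set.ncard_empty]

theorem walkCount_zero_zero (δ y : ℤ) : walkCount δ y 0 0 = if y = 0 then 1 else 0 := by
  rw [walkCount]
  split_ifs with h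
  · subst h
    rw [show walkWords δ 0 0 0 = {([], [])} by
      ext ⟨p, q⟩
      rw [Set.mem_singleton_iff, Prod.mk.injEq]
      constructor
      · rintro ⟨h1, h2, -⟩
        simp only [add_zero, Nat.cast_eq_zero] at h1 h2
        rw [h1] at h2
        exact ⟨List.length_eq_zero_iff.1 h1, List.length_eq_zero_iff.1 h2⟩
      · rintro ⟨rfl, rfl⟩
        exact ⟨rfl, rfl, rfl, rfl⟩, Set.ncard_singleton]
  · rw [show walkWords δ y 0 0 = ∅ by
      refine Set.eq_empty_of_forall_notMem ?_
      rintro ⟨p, q⟩ ⟨h1, h2, -, h4⟩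
      simp only [add_zero, Nat.cast_eq_zero] at h1 h2
      rw [h1] at h2
      rw [List.length_eq_zero_iff] at h1 h2
      subst h1 h2
      exact h h4, Set.ncard_empty]

/-- The number of walks whose first word begins with `a`. -/
noncomputable def riseCount (δ y d e : ℤ) : ℕ :=
  walkCount δ y (d - 1) e + walkCount δ (y - 1) (d - 1) e

/-- The number of walks whose first word begins with `b`. -/
noncomputable def fallCount (δ y d e : ℤ) : ℕ :=
  walkCount δ (y + 1) d (e - 1) + walkCount δ y d (e - 1)

theorem walkCount_eq {δ y d e : ℤ} (h : 0 < d + e) (h1 : 0 < y) (h2 : y < δ) :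
    walkCount δ y d e = riseCount δ y d e + fallCount δ y d e := by
  obtain ⟨N, hN⟩ : ∃ N : ℕ, d + e = (N + 1 : ℕ) := ⟨(d + e - 1).toNat, by omega⟩
  have key (c c' : Letter) :
      {w : Word × Word | (c :: w.1, c' :: w.2) ∈ walkWords δ y d e} =
        walkWords δ (y - (if c then 1 else 0) + if c' then 1 else 0) (d - if c then 1 else 0)
          (e - if c then 0 else 1) := by
    ext ⟨p, q⟩
    simp only [walkWords, Set.mem_ofPred_eq, List.length_cons, Nat.add_right_cancel_iff, cnt_cons,
      IsWalk, h1, h2, and_self, true_and]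
    refine and_congr ?_ (and_congr Iff.rfl (and_congr ?_ Iff.rfl))
    · cases c <;> push_cast <;> simp <;> omega
    · omega
  rw [walkCount, ncard_eq_sum_cons N (fun w hw => ?_)]
  · simp only [key, riseCount, fallCount, walkCount]
    simp
  · have h1 := hw.1
    have h2 := hw.2.1
    omega

/-! ### Decomposition of walks into runs -/

theorem sum_binom_zero {δ y : ℤ} (h1 : 0 < y) (h2 : y < δ) (f : ℤ → ℕ) :
    ∑ s ∈ Finset.Icc 1 (δ - 1), binom 0 (y - s) * f s = f y := by
  rw [Finset.sum_eq_single y]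
  · simp [binom_zero_left]
  · intro s _ hs
    rw [binom_zero_left, if_neg (by omega), zero_mul]
  · intro h
    exact absurd (Finset.mem_Icc.2 ⟨by omega, by omega⟩) h

theorem sum_binom_zero' {δ y : ℤ} (h1 : 0 < y) (h2 : y < δ) (f : ℤ → ℕ) :
    ∑ s ∈ Finset.Icc 1 (δ - 1), binom 0 (s - y) * f s = f y := by
  rw [← sum_binom_zero h1 h2 f]
  refine Finset.sum_congr rfl fun s _ => ?_
  simp only [binom_zero_left]
  congr 2
  exact propext (by omega)

/-- The index `n` is the length, possibly 0, of the initial run of `a` in the first word, and `s`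
the height after it. During the run the height drops exactly when the second word reads `b`, so y -
s of the n positions are chosen, and monotonicity makes the strip condition automatic. -/
theorem walkCount_eq_sum_rise {δ e : ℤ} (he : 0 < e) (d : ℕ) {y : ℤ} (h1 : 0 ≤ y) (h2 : y < δ) :
    walkCount δ y d e = ∑ n ∈ Finset.range (d + 1), ∑ s ∈ Finset.Icc 1 (δ - 1),
      binom n (y - s) * fallCount δ s (d - n) e := by
  -- Height 0 is admitted because one step down from height 1 leads there; since e > 0 the walk is
  -- not over, and both sides vanish.
  obtain rfl | h0 := h1.eq_or_lt
  · rw [walkCount_eq_zero (by omega), eq_comm]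
    refine Finset.sum_eq_zero fun n _ => Finset.sum_eq_zero fun s hs => ?_
    rw [Finset.mem_Icc] at hs
    rw [binom_of_neg (by omega), zero_mul]
  clear h1
  rename' h0 => h1
  induction d generalizing y with
  | zero =>
    rw [walkCount_eq (by omega) h1 h2, riseCount, walkCount_eq_zero (by omega),
      walkCount_eq_zero (by omega)]
    simp [sum_binom_zero h1 h2]
  | succ d ih =>
    have ih' : walkCount δ (y - 1) d e = ∑ n ∈ Finset.range (d + 1), ∑ s ∈ Finset.Icc 1 (δ - 1),
        binom n (y - 1 - s) * fallCount δ s (d - n) e := by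
      by_cases hy : 0 < y - 1
      · exact ih (by omega) hy
      · rw [walkCount_eq_zero (by omega), eq_comm]
        refine Finset.sum_eq_zero fun n _ => Finset.sum_eq_zero fun s hs => ?_
        rw [Finset.mem_Icc] at hs
        rw [binom_of_neg (by omega), zero_mul]
    rw [walkCount_eq (by omega) h1 h2, riseCount, Nat.cast_succ, add_sub_cancel_right, ih h2 h1,
      ih', Finset.sum_range_succ' _ (d + 1), Nat.cast_zero, sum_binom_zero h1 h2, sub_zero,
      ← Finset.sum_add_distrib]
    congr 1
    refine Finset.sum_congr rfl fun n _ => ?_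
    rw [← Finset.sum_add_distrib]
    refine Finset.sum_congr rfl fun s _ => ?_
    rw [Nat.cast_succ, binom_succ (by omega), add_sub_add_right_eq_sub,
      show y - s - 1 = y - 1 - s by ring, add_mul]

/-- Mirror image of `walkCount_eq_sum_rise`: along a run of `b` the height rises exactly when the
second word reads `a`, and now the boundary height that contributes nothing is δ. -/
theorem walkCount_eq_sum_fall {δ d : ℤ} (hd : 0 < d) (e : ℕ) {y : ℤ} (h1 : 0 < y) (h2 : y ≤ δ) :
    walkCount δ y d e = ∑ n ∈ Finset.range (e + 1), ∑ t ∈ Finset.Icc 1 (δ - 1),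
      binom n (t - y) * riseCount δ t d (e - n) := by
  obtain rfl | h0 := h2.eq_or_lt
  · rw [walkCount_eq_zero (by omega), eq_comm]
    refine Finset.sum_eq_zero fun n _ => Finset.sum_eq_zero fun s hs => ?_
    rw [Finset.mem_Icc] at hs
    rw [binom_of_neg (by omega), zero_mul]
  clear h2
  rename' h0 => h2
  induction e generalizing y with
  | zero =>
    rw [walkCount_eq (by omega) h1 h2, fallCount, walkCount_eq_zero (y := y + 1) (by omega),
      walkCount_eq_zero (d := d) (by omega)]
    simp [sum_binom_zero' h1 h2]
  | succ e ih =>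
    have ih' : walkCount δ (y + 1) d e = ∑ n ∈ Finset.range (e + 1), ∑ t ∈ Finset.Icc 1 (δ - 1),
        binom n (t - (y + 1)) * riseCount δ t d (e - n) := by
      by_cases hy : y + 1 < δ
      · exact ih (by omega) hy
      · rw [walkCount_eq_zero (by omega), eq_comm]
        refine Finset.sum_eq_zero fun n _ => Finset.sum_eq_zero fun s hs => ?_
        rw [Finset.mem_Icc] at hs
        rw [binom_of_neg (by omega), zero_mul]
    rw [walkCount_eq (by omega) h1 h2, fallCount, Nat.cast_succ, add_sub_cancel_right, ih h1 h2,
      ih', Finset.sum_range_succ' _ (e + 1), Nat.cast_zero, sum_binom_zero' h1 h2, sub_zero,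
      ← Finset.sum_add_distrib, add_comm]
    congr 1
    refine Finset.sum_congr rfl fun n _ => ?_
    rw [← Finset.sum_add_distrib]
    refine Finset.sum_congr rfl fun s _ => ?_
    rw [Nat.cast_succ, binom_succ (by omega), add_sub_add_right_eq_sub,
      show s - y - 1 = s - (y + 1) by ring, add_mul, add_comm]

theorem sum_Icc_eq_sum_range {M : ℤ} {d : ℕ} (hd : d ≤ M) {f : ℤ → ℕ}
    (hf : ∀ n : ℤ, d < n → f n = 0) :
    ∑ n ∈ Finset.Icc 1 M, f n = ∑ n ∈ Finset.range d, f (n + 1) := by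
  rw [← Finset.sum_subset (Finset.Icc_subset_Icc_right hd)
    (fun n _ hn => hf n (by simp only [Finset.mem_Icc] at *; omega))]
  refine Finset.sum_bij' (fun n _ => (n - 1).toNat) (fun n _ => (n : ℤ) + 1) ?_ ?_ ?_ ?_ ?_ <;>
    simp only [Finset.mem_Icc, Finset.mem_range] <;> intro n hn
  · omega
  · omega
  · omega
  · omega
  · rw [show ((n - 1).toNat : ℤ) + 1 = n by omega]

/-- Here `n` also counts one letter `a` read earlier, so runs have positive length but only n - 1
free positions. The bound `M` gives all run lengths one range, independent of the letters left; the
excess terms vanish. -/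
theorem walkCount_eq_sum_first {δ d e M : ℤ} (he : 0 < e) (hM : d ≤ M) {y : ℤ} (h1 : 0 ≤ y)
    (h2 : y < δ) : walkCount δ y (d - 1) e = ∑ n ∈ Finset.Icc 1 M, ∑ s ∈ Finset.Icc 1 (δ - 1),
      binom (n - 1) (y - s) * fallCount δ s (d - n) e := by
  have fall0 (n s : ℤ) (hn : d < n) : fallCount δ s (d - n) e = 0 := by
    rw [fallCount, walkCount_eq_zero (by omega), walkCount_eq_zero (by omega)]
  by_cases hd : 0 < d
  · obtain ⟨D, rfl⟩ : ∃ D : ℕ, d = D + 1 := ⟨(d - 1).toNat, by omega⟩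
    rw [add_sub_cancel_right, walkCount_eq_sum_rise he D h1 h2,
      sum_Icc_eq_sum_range (d := D + 1) (by push_cast; omega)]
    · simp only [add_sub_cancel_right, add_sub_add_right_eq_sub]
    · intro n hn
      exact Finset.sum_eq_zero fun s _ => by rw [fall0 n s (by push_cast at hn; omega), mul_zero]
  · rw [walkCount_eq_zero (by omega), eq_comm]
    refine Finset.sum_eq_zero fun n hn => Finset.sum_eq_zero fun s _ => ?_
    rw [Finset.mem_Icc] at hn
    rw [fall0 n s (by omega), mul_zero]

theorem riseCount_eq_sum {δ d e M : ℤ} (he : 0 < e) (hM : d ≤ M) {y : ℤ} (h1 : 0 < y) (h2 : y < δ) :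
    riseCount δ y d e = ∑ n ∈ Finset.Icc 1 M, ∑ s ∈ Finset.Icc 1 (δ - 1),
      binom n (y - s) * fallCount δ s (d - n) e := by
  rw [riseCount, walkCount_eq_sum_first he hM h1.le h2,
    walkCount_eq_sum_first he hM (by omega) (by omega), ← Finset.sum_add_distrib]
  refine Finset.sum_congr rfl fun n hn => ?_
  rw [← Finset.sum_add_distrib]
  refine Finset.sum_congr rfl fun s _ => ?_
  rw [Finset.mem_Icc] at hn
  have := binom_succ (n := n - 1) (by omega) (y - s)
  rw [sub_add_cancel] at this
  rw [this, show y - s - 1 = y - 1 - s by ring, add_mul]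

/-- Without a letter `a` in the first word the height never falls, so it cannot reach 0. -/
theorem walkCount_zero_left (δ y : ℤ) {e : ℤ} (he : 0 < e) (h1 : 0 < y) :
    walkCount δ y 0 e = 0 := by
  obtain ⟨E, rfl⟩ : ∃ E : ℕ, e = E + 1 := ⟨(e - 1).toNat, by omega⟩
  clear he
  induction E generalizing y with
  | zero =>
    by_cases h2 : y < δ
    · rw [walkCount_eq (by omega) h1 h2, riseCount, fallCount, walkCount_eq_zero (d := 0 - 1)
        (by omega), walkCount_eq_zero (d := 0 - 1) (by omega)]
      simp only [Nat.cast_zero, zero_add, sub_self, walkCount_zero_zero]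
      rw [if_neg (by omega), if_neg (by omega)]
    · exact walkCount_eq_zero (by omega)
  | succ E ih =>
    by_cases h2 : y < δ
    · rw [walkCount_eq (by omega) h1 h2, riseCount, fallCount, walkCount_eq_zero (d := 0 - 1)
        (by omega), walkCount_eq_zero (d := 0 - 1) (by omega), Nat.cast_succ, add_sub_cancel_right,
        ih _ (by omega), ih _ h1]
    · exact walkCount_eq_zero (by omega)

theorem fallCount_eq_sum {δ d e M : ℤ} (he : 0 < e) (hM : e ≤ M) {y : ℤ} (h1 : 0 < y) (h2 : y < δ) :
    fallCount δ y d e = ∑ n ∈ Finset.Icc 1 M, ∑ t ∈ Finset.Icc 1 (δ - 1),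
      binom n (t - y) * riseCount δ t d (e - n) := by
  obtain ⟨E, rfl⟩ : ∃ E : ℕ, e = E + 1 := ⟨(e - 1).toNat, by omega⟩
  by_cases hd : 0 < d
  · rw [sum_Icc_eq_sum_range (d := E + 1) (by push_cast; omega), fallCount, add_sub_cancel_right,
      walkCount_eq_sum_fall hd E (by omega) (by omega), walkCount_eq_sum_fall hd E h1 h2.le,
      ← Finset.sum_add_distrib]
    · refine Finset.sum_congr rfl fun n hn => ?_
      rw [← Finset.sum_add_distrib]
      refine Finset.sum_congr rfl fun s _ => ?_
      rw [binom_succ (by omega), add_sub_add_right_eq_sub, show s - y - 1 = s - (y + 1) by ring,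
        add_mul, add_comm]
    · intro n hn
      refine Finset.sum_eq_zero fun s _ => ?_
      push_cast at hn
      rw [riseCount, walkCount_eq_zero (by omega), walkCount_eq_zero (by omega), add_zero, mul_zero]
  · have hr (t n : ℤ) : riseCount δ t d (E + 1 - n) = 0 := by
      rw [riseCount, walkCount_eq_zero (by omega), walkCount_eq_zero (by omega)]
    simp only [hr, mul_zero, Finset.sum_const_zero]
    rw [fallCount]
    obtain hd | rfl := (not_lt.1 hd).lt_or_eq
    · rw [walkCount_eq_zero (by omega), walkCount_eq_zero (by omega), add_zero]
    · rw [add_sub_cancel_right]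
      obtain rfl | hE := Nat.eq_zero_or_pos E
      · simp only [Nat.cast_zero, walkCount_zero_zero]
        rw [if_neg (by omega), if_neg (by omega), add_zero]
      · rw [walkCount_zero_left _ _ (by omega) (by omega), walkCount_zero_left _ _ (by omega) h1,
          add_zero]

/-- With only letters `a` left the height must drop y times, and the last step must be a drop since
0 is reached only at the end. The other y - 1 drops are free among d - 1 positions. -/
theorem riseCount_zero_right {δ : ℤ} (d : ℤ) {y : ℤ} (h1 : 0 < y) (h2 : y < δ) :
    riseCount δ y d 0 = binom (d - 1) (y - 1) := by
  by_cases hd : 0 < d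
  · obtain ⟨D, rfl⟩ : ∃ D : ℕ, d = D + 1 := ⟨(d - 1).toNat, by omega⟩
    clear hd
    induction D generalizing y with
    | zero =>
      simp only [riseCount, Nat.cast_zero, zero_add, sub_self, walkCount_zero_zero, binom_zero_left]
      rw [if_neg (by omega), zero_add]
    | succ D ih =>
      have key (z : ℤ) (h0 : 0 ≤ z) (hz : z < δ) :
          walkCount δ z (D + 1) 0 = binom D (z - 1) := by
        obtain rfl | h0 := h0.eq_or_lt
        · rw [walkCount_eq_zero (by omega), binom_of_neg (by omega)]
        · rw [walkCount_eq (by omega) h0 hz, fallCount, walkCount_eq_zero (e := 0 - 1) (by omega),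
            walkCount_eq_zero (e := 0 - 1) (by omega), ih h0 hz, add_sub_cancel_right, add_zero,
            add_zero]
      rw [riseCount, add_sub_cancel_right, Nat.cast_succ, key y h1.le h2, key (y - 1) (by omega)
        (by omega), binom_succ (by omega)]
  · rw [binom_of_lt (by omega), riseCount, walkCount_eq_zero (by omega),
      walkCount_eq_zero (by omega)]

theorem walkCount_zero_right {δ d y : ℤ} (h1 : 0 < y) (h2 : y < δ) :
    walkCount δ y d 0 = binom (d - 1) (y - 1) := by
  obtain hd | rfl | hd := lt_trichotomy d 0
  · rw [walkCount_eq_zero (by omega), binom_of_lt (by omega)]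
  · rw [walkCount_zero_zero, if_neg (by omega), binom_of_lt (by omega)]
  · rw [walkCount_eq (by omega) h1 h2, riseCount_zero_right d h1 h2, fallCount,
      walkCount_eq_zero (e := 0 - 1) (by omega), walkCount_eq_zero (e := 0 - 1) (by omega), add_zero,
      add_zero]

/-! ### Confined pairs of words as walks -/

theorem ncard_confinedWords {g : ℕ} (hg : 1 ≤ g) {δ : ℤ} (hδ : 2 ≤ δ) {x y : ℤ} (hxy : x - y = δ) :
    (confinedWords g x y).ncard = walkCount δ (δ - 1) (x - 1) (g - x) := by
  have hinj : Function.Injective (fun w : Word × Word => (true :: w.1, false :: w.2)) := by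
    rintro ⟨p, q⟩ ⟨p', q'⟩ h
    simpa using h
  rw [walkCount, ← Set.ncard_image_of_injective (walkWords _ _ _ _) hinj]
  congr 1
  ext ⟨p, q⟩
  simp only [Set.mem_image, Prod.exists, Prod.mk.injEq, confinedWords, walkWords,
    Set.mem_ofPred_eq, isWalk_iff, hxy]
  constructor
  · rintro ⟨h1, h2, h3, h4, h5, h6⟩
    set f : ℕ → ℤ := fun t => δ - cnt (p.take t) + cnt (q.take t) with hf
    have up (t : ℕ) : f (t + 1) ≤ f t + 1 := by
      have := cnt_take_succ_sub p t
      have := cnt_take_succ_sub q t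
      simp only [hf]; omega
    have down (t : ℕ) : f t - 1 ≤ f (t + 1) := by
      have := cnt_take_succ_sub p t
      have := cnt_take_succ_sub q t
      simp only [hf]; omega
    have f0 : f 0 = δ := by simp [hf]
    have fg : f g = 0 := by
      have e1 : p.take g = p := by rw [← h1, List.take_length]
      have e2 : q.take g = q := by rw [← h2, List.take_length]
      simp only [hf, e1, e2]; omega
    have ne1 (t : ℕ) (h : 1 ≤ t) (h' : t ≤ g) : f t ≠ δ := by
      have := h6 t h' (by omega)
      simp only [hf]; omega
    have ne0 (t : ℕ) (h' : t ≤ g - 1) : f t ≠ 0 := by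
      have := h5 t (by omega) (by omega)
      simp only [hf]; omega
    -- From above δ the height could not return to 0 by steps of size at most one without hitting δ
    -- again.
    have f1 : f 1 < δ := by
      by_contra hcon
      have := stays_above (c := δ) down (s := 1) (e := g)
        (lt_of_le_of_ne (not_lt.1 hcon) (ne1 1 le_rfl hg).symm) ne1 hg le_rfl
      omega
    have lt_δ (t : ℕ) (h : 1 ≤ t) (h' : t ≤ g) : f t < δ := stays_below up f1 ne1 h h'
    have pos (t : ℕ) (h' : t ≤ g - 1) : 0 < f t :=
      stays_above down (s := 0) (by omega) (fun t _ h => ne0 t h) (Nat.zero_le t) h'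
    match p, q with
    | [], _ => simp at h1; omega
    | _ :: _, [] => simp at h2; omega
    | c :: p, c' :: q =>
      -- Only this pair of letters lowers the height, so the first letters are forced and the walk
      -- proper starts at δ - 1.
      have hcc : c = true ∧ c' = false := by
        simp only [hf, List.take_succ_cons, List.take_zero, cnt_cons, cnt_nil] at f1
        cases c <;> cases c' <;> simp at f1 ⊢
      obtain ⟨rfl, rfl⟩ := hcc
      simp only [List.length_cons, cnt_cons, if_true] at h1 h2 h3 h4
      refine ⟨p, q, ⟨by omega, by omega, by omega, by omega, ?_, fun t ht => ?_⟩, rfl, rfl⟩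
      · simp at h4; omega
      · have a1 := lt_δ (t + 1) (by omega) (by omega)
        have a2 := pos (t + 1) (by omega)
        simp only [hf, List.take_succ_cons, cnt_cons, if_true] at a1 a2
        simp at a1 a2
        constructor <;> omega
  · rintro ⟨p, q, ⟨h1, h2, h3, h4, h5, h6⟩, rfl, rfl⟩
    simp only [List.length_cons, cnt_cons, if_true]
    refine ⟨by omega, by omega, by omega, by simp; omega, fun t ht hN => ?_, fun t ht h0 => ?_⟩
    · cases t with
      | zero => simp; omega
      | succ t =>
        have := h6 t (by omega)
        simp; omega
    · cases t with
      | zero => exact absurd rfl h0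
      | succ t =>
        simp only [List.take_succ_cons, cnt_cons, if_true]
        -- The final time has height 0, outside the strip that bounds all earlier times.
        by_cases ht' : t = p.length
        · subst ht'
          have e : q.take p.length = q := by rw [h4, List.take_length]
          rw [List.take_length, e]
          simp; omega
        · have := h6 t (by omega)
          simp; omega

/-! ### Sums over tuples -/

/-- The sequence `f` with `x` put in front of its entries from index `1` on. -/
def consEntry (x : ℤ) (f : ℕ → ℤ) : ℕ → ℤ
  | 0 => 0
  | 1 => x
  | t + 2 => f (t + 1)

theorem entry_cons {N : ℕ} (x : ℤ) (f : Fin N → ℤ) :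
    entry (Fin.cons x f : Fin (N + 1) → ℤ) = consEntry x (entry f) := by
  funext t
  match t with
  | 0 => rfl
  | 1 =>
    rw [entry, dif_pos (by omega)]
    rfl
  | t + 2 =>
    rw [consEntry, entry, entry]
    by_cases h : t + 1 ≤ N
    · rw [dif_pos (by omega), dif_pos (by omega)]
      rfl
    · rw [dif_neg (by omega), dif_neg (by omega)]

theorem consEntry_consEntry (x y : ℤ) (f : ℕ → ℤ) {t : ℕ} (ht : 1 ≤ t) :
    consEntry x (consEntry y f) (t + 2) = f t := by
  obtain ⟨t, rfl⟩ : ∃ s, t = s + 1 := ⟨t - 1, by omega⟩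
  rfl

/-- The sum of `F` over the `N`-tuples with entries in `s`. -/
noncomputable def tupleSum (N : ℕ) (s : Finset ℤ) (F : (ℕ → ℤ) → ℕ) : ℕ :=
  ∑ f ∈ Fintype.piFinset (fun _ : Fin N => s), F (entry f)

theorem tupleSum_zero (s : Finset ℤ) (F : (ℕ → ℤ) → ℕ) : tupleSum 0 s F = F fun _ => 0 := by
  rw [tupleSum, Fintype.piFinset_of_isEmpty, Fintype.sum_unique]
  congr 1
  funext t
  rw [entry, dif_neg (by omega)]

theorem tupleSum_succ (N : ℕ) (s : Finset ℤ) (F : (ℕ → ℤ) → ℕ) :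
    tupleSum (N + 1) s F = ∑ x ∈ s, tupleSum N s fun f => F (consEntry x f) := by
  simp only [tupleSum]
  rw [← Finset.sum_product']
  refine Finset.sum_bij' (fun f _ => (f 0, Fin.tail f)) (fun y _ => Fin.cons y.1 y.2) ?_ ?_ ?_ ?_ ?_
  · intro f hf
    rw [Fintype.mem_piFinset] at hf
    exact Finset.mem_product.2 ⟨hf 0, Fintype.mem_piFinset.2 fun i => hf i.succ⟩
  · intro y hy
    obtain ⟨h1, h2⟩ := Finset.mem_product.1 hy
    rw [Fintype.mem_piFinset] at h2 ⊢
    exact Fin.cases h1 h2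
  · intro f _
    exact Fin.cons_self_tail f
  · intro y _
    simp
  · intro f _
    rw [← entry_cons, Fin.cons_self_tail]

theorem tupleSum_congr {N : ℕ} {s : Finset ℤ} {F G : (ℕ → ℤ) → ℕ} (h : ∀ f, F f = G f) :
    tupleSum N s F = tupleSum N s G :=
  Finset.sum_congr rfl fun f _ => h (entry f)

theorem mul_tupleSum (N : ℕ) (s : Finset ℤ) (c : ℕ) (F : (ℕ → ℤ) → ℕ) :
    c * tupleSum N s F = tupleSum N s fun f => c * F f :=
  Finset.mul_sum _ _ _

theorem tupleSum_sum_comm {ι : Type*} (N : ℕ) (s : Finset ℤ) (I : Finset ι)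
    (F : ι → (ℕ → ℤ) → ℕ) :
    tupleSum N s (fun f => ∑ i ∈ I, F i f) = ∑ i ∈ I, tupleSum N s (F i) :=
  Finset.sum_comm

theorem Icc_succ_right_eq {a b : ℕ} (h : a ≤ b + 1) :
    Finset.Icc a (b + 1) = insert a ((Finset.Icc a b).map (addRightEmbedding 1)) := by
  ext t
  simp only [Finset.mem_Icc, Finset.mem_insert, Finset.mem_map, addRightEmbedding_apply]
  constructor
  · rintro ⟨h1, h2⟩
    by_cases h : t = a
    · exact Or.inl h
    · exact Or.inr ⟨t - 1, by omega, by omega⟩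
  · rintro (rfl | ⟨t, h1, rfl⟩) <;> omega

theorem notMem_map_succ {a b : ℕ} : a ∉ (Finset.Icc a b).map (addRightEmbedding 1) := by
  simp only [Finset.mem_Icc, Finset.mem_map, addRightEmbedding_apply]
  rintro ⟨t, h1, h2⟩
  omega

theorem sum_Icc_succ_eq {α : Type*} [AddCommMonoid α] {a b : ℕ} (h : a ≤ b + 1) (f : ℕ → α) :
    ∑ t ∈ Finset.Icc a (b + 1), f t = f a + ∑ t ∈ Finset.Icc a b, f (t + 1) := by
  rw [Icc_succ_right_eq h, Finset.sum_insert notMem_map_succ, Finset.sum_map]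
  rfl

theorem prod_Icc_succ_eq {α : Type*} [CommMonoid α] {a b : ℕ} (h : a ≤ b + 1) (f : ℕ → α) :
    ∏ t ∈ Finset.Icc a (b + 1), f t = f a * ∏ t ∈ Finset.Icc a b, f (t + 1) := by
  rw [Icc_succ_right_eq h, Finset.prod_insert notMem_map_succ, Finset.prod_map]
  rfl

/-! ### Sums over run lengths and heights -/

/-- The number of ways to realize the run lengths `ν` and heights `σ`, where `Φ` is the
contribution of the first run. -/
def runWeight (Φ : ℤ → ℤ → ℕ) (r : ℕ) (ν σ : ℕ → ℤ) : ℕ :=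
  Φ (ν 1) (σ 1) * binom (ν 2) (σ 2 - σ 1) *
    binom (ν (2 * r - 1) - 1) (ν (2 * r - 1) - σ (2 * r - 2)) *
    ∏ e ∈ Finset.Icc 2 (r - 1),
      (binom (ν (2 * e - 1)) (ν (2 * e - 1) + σ (2 * e - 1) - σ (2 * e - 2)) *
        binom (ν (2 * e)) (σ (2 * e) - σ (2 * e - 1)))

/-- The sum of `runWeight` over all run lengths with sums `d` and `e` and all heights. -/
noncomputable def blockSum (M δ : ℤ) (Φ : ℤ → ℤ → ℕ) (r : ℕ) (d e : ℤ) : ℕ :=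
  tupleSum (2 * r - 1) (Finset.Icc 1 M) fun ν =>
    if ∑ t ∈ Finset.Icc 1 r, ν (2 * t - 1) = d ∧ ∑ t ∈ Finset.Icc 1 (r - 1), ν (2 * t) = e then
      tupleSum (2 * r - 2) (Finset.Icc 1 (δ - 1)) fun σ => runWeight Φ r ν σ
    else 0

/-- Once two runs are removed, the next run of `a` becomes the first and starts from height `t`. Its
factor then has a different shape from the original first factor, which is why `Φ` is a parameter.
-/
theorem runWeight_consEntry (Φ : ℤ → ℤ → ℕ) (r : ℕ) (n n' s t : ℤ) (ν σ : ℕ → ℤ) :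
    runWeight Φ (r + 3) (consEntry n (consEntry n' ν)) (consEntry s (consEntry t σ)) =
      Φ n s * (binom n' (t - s) * runWeight (fun m z => binom m (t - z)) (r + 2) ν σ) := by
  have c1 (i : ℕ) (hi : 1 ≤ i) : consEntry n (consEntry n' ν) (i + 2) = ν i :=
    consEntry_consEntry n n' ν hi
  have c2 (i : ℕ) (hi : 1 ≤ i) : consEntry s (consEntry t σ) (i + 2) = σ i :=
    consEntry_consEntry s t σ hi
  have a1 : consEntry n (consEntry n' ν) 1 = n := rfl
  have a2 : consEntry n (consEntry n' ν) 2 = n' := rfl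
  have b1 : consEntry s (consEntry t σ) 1 = s := rfl
  have b2 : consEntry s (consEntry t σ) 2 = t := rfl
  generalize consEntry n (consEntry n' ν) = ν' at *
  generalize consEntry s (consEntry t σ) = σ' at *
  have hprod : ∏ e ∈ Finset.Icc 2 (r + 1),
      (binom (ν' (2 * (e + 1) - 1)) (ν' (2 * (e + 1) - 1) + σ' (2 * (e + 1) - 1) -
        σ' (2 * (e + 1) - 2)) * binom (ν' (2 * (e + 1))) (σ' (2 * (e + 1)) - σ' (2 * (e + 1) - 1))) =
      ∏ e ∈ Finset.Icc 2 (r + 1),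
        (binom (ν (2 * e - 1)) (ν (2 * e - 1) + σ (2 * e - 1) - σ (2 * e - 2)) *
          binom (ν (2 * e)) (σ (2 * e) - σ (2 * e - 1))) := by
    refine Finset.prod_congr rfl fun i hi => ?_
    rw [Finset.mem_Icc] at hi
    rw [show 2 * (i + 1) - 1 = 2 * i - 1 + 2 by omega,
      show 2 * (i + 1) - 2 = 2 * i - 2 + 2 by omega, show 2 * (i + 1) = 2 * i + 2 by omega,
      c1 (2 * i - 1) (by omega), c1 (2 * i) (by omega), c2 (2 * i - 1) (by omega),
      c2 (2 * i) (by omega), c2 (2 * i - 2) (by omega)]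
  rw [runWeight, runWeight, show r + 3 - 1 = r + 1 + 1 by omega, prod_Icc_succ_eq (by omega), hprod,
    show r + 2 - 1 = r + 1 by omega, show 2 * (r + 3) - 1 = 2 * (r + 2) - 1 + 2 by omega,
    show 2 * (r + 3) - 2 = 2 * (r + 2) - 2 + 2 by omega, c1 (2 * (r + 2) - 1) (by omega),
    c2 (2 * (r + 2) - 2) (by omega), show 2 * 2 - 1 = 1 + 2 from rfl, show 2 * 2 - 2 = 2 from rfl,
    show 2 * 2 = 2 + 2 from rfl, c1 1 le_rfl, c1 2 (by omega), c2 1 le_rfl, c2 2 (by omega), a1, a2,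
    b1, b2, ← binom_symm (a := ν 1) (b := t - σ 1), show ν 1 - (t - σ 1) = ν 1 + σ 1 - t by ring]
  ring

theorem mul_sum_sum_comm {ι κ μ : Type*} (I : Finset ι) (K : Finset κ) (L : Finset μ) (f : ι → ℕ)
    (G : ι → κ → μ → ℕ) : ∑ s ∈ I, f s * ∑ n ∈ K, ∑ t ∈ L, G s n t =
      ∑ n ∈ K, ∑ s ∈ I, ∑ t ∈ L, f s * G s n t := by
  simp only [Finset.mul_sum]
  exact Finset.sum_comm

/-- Peeling off the first two runs. -/
theorem blockSum_succ (M δ : ℤ) (Φ : ℤ → ℤ → ℕ) (r : ℕ) (d e : ℤ) :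
    blockSum M δ Φ (r + 3) d e = ∑ n ∈ Finset.Icc 1 M, ∑ s ∈ Finset.Icc 1 (δ - 1), Φ n s *
      ∑ n' ∈ Finset.Icc 1 M, ∑ t ∈ Finset.Icc 1 (δ - 1), binom n' (t - s) *
        blockSum M δ (fun m z => binom m (t - z)) (r + 2) (d - n) (e - n') := by
  have hc (n n' : ℤ) (ν : ℕ → ℤ) :
      (∑ t ∈ Finset.Icc 1 (r + 3), consEntry n (consEntry n' ν) (2 * t - 1) = d ∧
        ∑ t ∈ Finset.Icc 1 (r + 3 - 1), consEntry n (consEntry n' ν) (2 * t) = e) ↔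
      (∑ t ∈ Finset.Icc 1 (r + 2), ν (2 * t - 1) = d - n ∧
        ∑ t ∈ Finset.Icc 1 (r + 2 - 1), ν (2 * t) = e - n') := by
    have h1 : ∑ t ∈ Finset.Icc 1 (r + 2), consEntry n (consEntry n' ν) (2 * (t + 1) - 1) =
        ∑ t ∈ Finset.Icc 1 (r + 2), ν (2 * t - 1) := by
      refine Finset.sum_congr rfl fun t ht => ?_
      rw [Finset.mem_Icc] at ht
      rw [show 2 * (t + 1) - 1 = 2 * t - 1 + 2 by omega, consEntry_consEntry _ _ _ (by omega)]
    have h2 : ∑ t ∈ Finset.Icc 1 (r + 1), consEntry n (consEntry n' ν) (2 * (t + 1)) =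
        ∑ t ∈ Finset.Icc 1 (r + 1), ν (2 * t) := by
      refine Finset.sum_congr rfl fun t ht => ?_
      rw [Finset.mem_Icc] at ht
      rw [show 2 * (t + 1) = 2 * t + 2 by omega, consEntry_consEntry _ _ _ (by omega)]
    rw [show r + 3 - 1 = r + 1 + 1 by omega, show r + 3 = r + 2 + 1 by omega,
      sum_Icc_succ_eq (b := r + 2) (by omega), h1,
      sum_Icc_succ_eq (b := r + 1) (by omega) fun t => consEntry n (consEntry n' ν) (2 * t), h2,
      show r + 2 - 1 = r + 1 by omega, show 2 * 1 - 1 = 1 from rfl, show 2 * 1 = 2 from rfl,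
      show consEntry n (consEntry n' ν) 1 = n from rfl,
      show consEntry n (consEntry n' ν) 2 = n' from rfl]
    constructor <;> rintro ⟨h1, h2⟩ <;> constructor <;> linarith
  simp only [blockSum]
  rw [show 2 * (r + 3) - 1 = 2 * (r + 2) - 1 + 1 + 1 by omega,
    show 2 * (r + 3) - 2 = 2 * (r + 2) - 2 + 1 + 1 by omega]
  simp only [tupleSum_succ, hc, runWeight_consEntry]
  refine Finset.sum_congr rfl fun n _ => ?_
  rw [mul_sum_sum_comm]
  refine Finset.sum_congr rfl fun n' _ => ?_
  trans tupleSum (2 * (r + 2) - 1) (Finset.Icc 1 M) fun ν =>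
    ∑ s ∈ Finset.Icc 1 (δ - 1), ∑ t ∈ Finset.Icc 1 (δ - 1), Φ n s * (binom n' (t - s) *
      if ∑ t ∈ Finset.Icc 1 (r + 2), ν (2 * t - 1) = d - n ∧
        ∑ t ∈ Finset.Icc 1 (r + 2 - 1), ν (2 * t) = e - n' then
        tupleSum (2 * (r + 2) - 2) (Finset.Icc 1 (δ - 1)) fun σ =>
          runWeight (fun m z => binom m (t - z)) (r + 2) ν σ else 0)
  · refine tupleSum_congr fun ν => ?_
    split_ifs with h
    · simp only [← mul_tupleSum]
    · simp
  · rw [tupleSum_sum_comm]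
    refine Finset.sum_congr rfl fun s _ => ?_
    rw [tupleSum_sum_comm]
    refine Finset.sum_congr rfl fun t _ => ?_
    rw [mul_tupleSum, mul_tupleSum]

theorem blockSum_two {M δ : ℤ} (Φ : ℤ → ℤ → ℕ) {d : ℤ} (hd : d ≤ M) (e : ℤ) :
    blockSum M δ Φ 2 d e = ∑ n ∈ Finset.Icc 1 M, ∑ s ∈ Finset.Icc 1 (δ - 1), Φ n s *
      ∑ n' ∈ Finset.Icc 1 M, ∑ t ∈ Finset.Icc 1 (δ - 1), binom n' (t - s) *
        if e - n' = 0 then binom (d - n - 1) (t - 1) else 0 := by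
  have hi (f : ℕ → ℤ) : ∑ t ∈ Finset.Icc 1 2, f t = f 1 + f 2 := by
    rw [sum_Icc_succ_eq (by omega)]
    simp
  simp only [blockSum, Nat.reduceMul, Nat.reduceSub, tupleSum_succ, tupleSum_zero, runWeight,
    Finset.Icc_self, Finset.sum_singleton, hi,
    show Finset.Icc 2 1 = ∅ from rfl, Finset.prod_empty, mul_one]
  refine Finset.sum_congr rfl fun n hn => ?_
  rw [mul_sum_sum_comm]
  refine Finset.sum_congr rfl fun n' _ => ?_
  simp only [consEntry]
  have hn := Finset.mem_Icc.1 hn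
  by_cases he : n' = e
  · subst he
    simp only [and_true, sub_self, if_true]
    by_cases h : 1 ≤ d - n
    · rw [Finset.sum_eq_single (d - n), if_pos (by ring)]
      · refine Finset.sum_congr rfl fun s _ => Finset.sum_congr rfl fun t _ => ?_
        rw [← binom_symm (a := d - n - 1) (b := t - 1), show d - n - 1 - (t - 1) = d - n - t by ring, mul_assoc]
      · intro m _ hm
        rw [if_neg (by omega)]
      · intro h'
        exact absurd (Finset.mem_Icc.2 ⟨h, by omega⟩) h'
    · rw [Finset.sum_eq_zero fun m hm => if_neg (by rw [Finset.mem_Icc] at hm; omega), eq_comm]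
      refine Finset.sum_eq_zero fun s _ => Finset.sum_eq_zero fun t ht => ?_
      rw [Finset.mem_Icc] at ht
      rw [binom_of_lt (a := d - n - 1) (by omega), mul_zero, mul_zero]
  · simp only [he, and_false, if_false, sub_eq_zero, Ne.symm he, mul_zero, Finset.sum_const_zero]

/-- The contribution to `riseCount` of the walks whose first word has `r + 1` runs of `a`. -/
noncomputable def runCount (M δ : ℤ) : ℕ → ℤ → ℤ → ℤ → ℕ
  | 0, y, d, e => if e = 0 then binom (d - 1) (y - 1) else 0
  | r + 1, y, d, e => ∑ n ∈ Finset.Icc 1 M, ∑ s ∈ Finset.Icc 1 (δ - 1), binom n (y - s) *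
      ∑ n' ∈ Finset.Icc 1 M, ∑ t ∈ Finset.Icc 1 (δ - 1), binom n' (t - s) *
        runCount M δ r t (d - n) (e - n')

/-- This turns the flat sum over tuples into the nested recursion satisfied by the walk counts. `Φ`
must stay arbitrary in the induction, since peeling replaces it. -/
theorem blockSum_eq {M δ : ℤ} (r : ℕ) (Φ : ℤ → ℤ → ℕ) {d : ℤ} (hd : d ≤ M) (e : ℤ) :
    blockSum M δ Φ (r + 2) d e = ∑ n ∈ Finset.Icc 1 M, ∑ s ∈ Finset.Icc 1 (δ - 1), Φ n s *
      ∑ n' ∈ Finset.Icc 1 M, ∑ t ∈ Finset.Icc 1 (δ - 1), binom n' (t - s) *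
        runCount M δ r t (d - n) (e - n') := by
  induction r generalizing Φ d e with
  | zero => exact blockSum_two Φ hd e
  | succ r ih =>
    rw [blockSum_succ]
    refine Finset.sum_congr rfl fun n hn => ?_
    rw [Finset.mem_Icc] at hn
    refine Finset.sum_congr rfl fun s _ => congrArg _ ?_
    refine Finset.sum_congr rfl fun n' _ => Finset.sum_congr rfl fun t _ => congrArg _ ?_
    rw [ih _ (by omega), runCount]

theorem runCount_of_neg (M δ : ℤ) (r : ℕ) (y d : ℤ) {e : ℤ} (he : e < 0) :
    runCount M δ r y d e = 0 := by
  induction r generalizing y d e with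
  | zero => rw [runCount, if_neg he.ne]
  | succ r ih =>
    rw [runCount]
    refine Finset.sum_eq_zero fun n _ => Finset.sum_eq_zero fun s _ => ?_
    rw [Finset.sum_eq_zero, mul_zero]
    intro n' hn'
    rw [Finset.mem_Icc] at hn'
    exact Finset.sum_eq_zero fun t _ => by rw [ih _ _ (by omega), mul_zero]

theorem runCount_succ_zero (M δ : ℤ) (r : ℕ) (y d : ℤ) : runCount M δ (r + 1) y d 0 = 0 := by
  rw [runCount]
  refine Finset.sum_eq_zero fun n _ => Finset.sum_eq_zero fun s _ => ?_
  rw [Finset.sum_eq_zero, mul_zero]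
  intro n' hn'
  rw [Finset.mem_Icc] at hn'
  exact Finset.sum_eq_zero fun t _ => by rw [runCount_of_neg _ _ _ _ _ (by omega), mul_zero]

theorem sum_two_runs (M δ : ℤ) (R : ℕ) (Φ : ℤ → ℤ → ℕ) (f : ℕ → ℤ → ℤ → ℤ → ℕ) (d e : ℤ) :
    ∑ n ∈ Finset.Icc 1 M, ∑ s ∈ Finset.Icc 1 (δ - 1), Φ n s *
      ∑ n' ∈ Finset.Icc 1 M, ∑ t ∈ Finset.Icc 1 (δ - 1), binom n' (t - s) *
        ∑ r ∈ Finset.range R, f r t (d - n) (e - n') =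
    ∑ r ∈ Finset.range R, ∑ n ∈ Finset.Icc 1 M, ∑ s ∈ Finset.Icc 1 (δ - 1), Φ n s *
      ∑ n' ∈ Finset.Icc 1 M, ∑ t ∈ Finset.Icc 1 (δ - 1), binom n' (t - s) *
        f r t (d - n) (e - n') := by
  induction R with
  | zero => simp
  | succ R ih =>
    rw [Finset.sum_range_succ, ← ih]
    simp only [Finset.sum_range_succ, mul_add, Finset.sum_add_distrib]

/-- Each level of the recursion uses at least one `a` and one `b`, so d + e ≤ 2R leaves nothing
after R levels. -/
theorem riseCount_eq_sum_runCount {M δ : ℤ} (R : ℕ) {y d e : ℤ} (h1 : 0 < y) (h2 : y < δ)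
    (hd : d ≤ M) (he : e ≤ M) (hR : d + e ≤ 2 * R) :
    riseCount δ y d e = ∑ r ∈ Finset.range R, runCount M δ r y d e := by
  induction R generalizing y d e with
  | zero =>
    rw [Nat.cast_zero] at hR
    rw [Finset.sum_range_zero, riseCount, walkCount_eq_zero (by omega),
      walkCount_eq_zero (by omega), add_zero]
  | succ R ih =>
    obtain he0 | rfl | he0 := lt_trichotomy e 0
    · rw [riseCount, walkCount_eq_zero (by omega), walkCount_eq_zero (by omega), add_zero,
        eq_comm]
      exact Finset.sum_eq_zero fun r _ => runCount_of_neg _ _ _ _ _ he0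
    · rw [Finset.sum_range_succ', Finset.sum_eq_zero fun r _ => runCount_succ_zero _ _ _ _ _,
        riseCount_zero_right d h1 h2, runCount, if_pos rfl, zero_add]
    · rw [Finset.sum_range_succ', runCount, if_neg he0.ne', add_zero, riseCount_eq_sum he0 hd h1 h2]
      simp only [runCount]
      rw [← sum_two_runs]
      refine Finset.sum_congr rfl fun n hn => Finset.sum_congr rfl fun s hs => congrArg _ ?_
      rw [Finset.mem_Icc] at hn hs
      rw [fallCount_eq_sum he0 he (by omega) (by omega)]
      refine Finset.sum_congr rfl fun n' hn' => Finset.sum_congr rfl fun t ht => congrArg _ ?_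
      rw [Finset.mem_Icc] at hn' ht
      push_cast at hR
      exact ih (by omega) (by omega) (by omega) (by omega) (by omega)

theorem walkCount_eq_sum_blockSum {M δ : ℤ} (R : ℕ) {d e : ℤ} (hδ : 2 ≤ δ) (he : 0 < e) (hd : d ≤ M)
    (heM : e ≤ M) (hR : d + e ≤ 2 * R + 2) : walkCount δ (δ - 1) (d - 1) e =
      ∑ r ∈ Finset.range R, blockSum M δ (fun n s => binom (n - 1) (δ - 1 - s)) (r + 2) d e := by
  simp only [blockSum_eq _ _ hd]
  rw [← sum_two_runs, walkCount_eq_sum_first he hd (by omega) (by omega)]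
  refine Finset.sum_congr rfl fun n hn => Finset.sum_congr rfl fun s hs => congrArg _ ?_
  rw [Finset.mem_Icc] at hn hs
  rw [fallCount_eq_sum he heM (by omega) (by omega)]
  refine Finset.sum_congr rfl fun n' hn' => Finset.sum_congr rfl fun t ht => congrArg _ ?_
  rw [Finset.mem_Icc] at hn' ht
  exact riseCount_eq_sum_runCount R (by omega) (by omega) (by omega) (by omega) (by omega)

/-! ### The triple sum -/

theorem sum_odd_add_sum_even (f : ℕ → ℤ) {r : ℕ} (hr : 1 ≤ r) :
    ∑ t ∈ Finset.Icc 1 (2 * r - 1), f t =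
      ∑ t ∈ Finset.Icc 1 r, f (2 * t - 1) + ∑ t ∈ Finset.Icc 1 (r - 1), f (2 * t) := by
  induction r, hr using Nat.le_induction with
  | base => simp
  | succ r hr ih =>
    obtain ⟨m, rfl⟩ : ∃ m, r = m + 1 := ⟨r - 1, by omega⟩
    rw [show 2 * (m + 1 + 1) - 1 = 2 * (m + 1) - 1 + 1 + 1 by omega,
      Finset.sum_Icc_succ_top (by omega), Finset.sum_Icc_succ_top (by omega), ih,
      Finset.sum_Icc_succ_top (a := 1) (b := m + 1) (by omega),
      show m + 1 + 1 - 1 = m + 1 by omega, show m + 1 - 1 = m by omega,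
      Finset.sum_Icc_succ_top (a := 1) (b := m) (by omega) fun t => f (2 * t),
      show 2 * (m + 1) - 1 + 1 = 2 * (m + 1) by omega,
      show 2 * (m + 1 + 1) - 1 = 2 * (m + 1) + 1 by omega]
    ring

theorem sum_Icc_eq_add {a b : ℕ} (h : a ≤ b) (f : ℕ → ℤ) :
    ∑ t ∈ Finset.Icc a b, f t = f a + ∑ t ∈ Finset.Icc (a + 1) b, f t := by
  rw [← Finset.add_sum_Ioc_eq_sum_Icc h]
  congr 2
  ext t
  simp only [Finset.mem_Ioc, Finset.mem_Icc]
  omega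

/-- In a nonvanishing term the height below `δ` after a run is at most the number of later
steps `a`. -/
theorem height_le_of_runWeight_ne_zero {Φ : ℤ → ℤ → ℕ} {r : ℕ} (hr : 2 ≤ r) {ν σ : ℕ → ℤ}
    (h : runWeight Φ r ν σ ≠ 0) {e : ℕ} (h1 : 1 ≤ e) (h2 : e ≤ r - 1) :
    σ (2 * e - 1) ≤ σ (2 * e) ∧ σ (2 * e) ≤ ∑ f ∈ Finset.Icc e (r - 1), ν (2 * f + 1) := by
  simp only [runWeight, mul_ne_zero_iff, Finset.prod_ne_zero_iff, Finset.mem_Icc] at h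
  obtain ⟨⟨⟨-, hf⟩, hl⟩, hp⟩ := h
  constructor
  · by_cases h : e = 1
    · subst h
      have := binom_ne_zero hf
      simp only [Nat.reduceMul, Nat.reduceSub]
      omega
    · have := binom_ne_zero (hp e ⟨by omega, h2⟩).2
      omega
  -- The last run must descend to 0, so it is at least as long as its starting height. Going
  -- backwards, the height before a run of `a` exceeds the height after it by at most the run's
  -- length, and the following run of `b` only raises the height.
  · induction h2 using Nat.decreasingInduction with
    | self =>
      have := binom_ne_zero hl
      rw [Finset.Icc_self, Finset.sum_singleton, show 2 * (r - 1) + 1 = 2 * r - 1 by omega,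
        show 2 * (r - 1) = 2 * r - 2 by omega]
      omega
    | of_succ e he ih =>
      have ih := ih (by omega)
      have b1 := binom_ne_zero (hp (e + 1) ⟨by omega, by omega⟩).1
      have b2 := binom_ne_zero (hp (e + 1) ⟨by omega, by omega⟩).2
      rw [sum_Icc_eq_add (by omega)]
      rw [show 2 * (e + 1) - 2 = 2 * e by omega, show 2 * (e + 1) - 1 = 2 * e + 1 by omega] at b1
      rw [show 2 * (e + 1) - 1 = 2 * e + 1 by omega] at b2
      omega

theorem offsetCond_of_runWeight_ne_zero {Φ : ℤ → ℤ → ℕ} {r : ℕ} (hr : 2 ≤ r) {δ d : ℤ}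
    (hδ : 1 ≤ δ) (hδd : δ ≤ d) {ν : Fin (2 * r - 1) → ℤ} {σ : Fin (2 * r - 2) → ℤ}
    (hν : ∑ t ∈ Finset.Icc 1 r, entry ν (2 * t - 1) = d)
    (hσ : σ ∈ Fintype.piFinset fun _ => Finset.Icc 1 (δ - 1))
    (h : runWeight Φ r (entry ν) (entry σ) ≠ 0) : OffsetCond r δ ν σ := by
  have bound (t : ℕ) (h1 : 1 ≤ t) (h2 : t ≤ 2 * r - 2) : entry σ t ∈ Finset.Icc 1 (δ - 1) := by
    rw [entry, dif_pos ⟨h1, h2⟩]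
    exact Fintype.mem_piFinset.1 hσ _
  have height {e : ℕ} (h1 : 1 ≤ e) (h2 : e ≤ r - 1) := height_le_of_runWeight_ne_zero hr h h1 h2
  set S : ℕ → ℤ := fun l => ∑ e ∈ Finset.Icc (l + 1) (r - 1), entry ν (2 * e + 1) with hS
  have Slast : S (r - 1) < δ := by
    simp only [hS]
    rw [Finset.Icc_eq_empty (by omega), Finset.sum_empty]
    omega
  have Sfirst : entry ν 1 + S 0 = d := by
    have first (f : ℕ → ℤ) (m : ℕ) (hm : 1 ≤ m) :
        ∑ t ∈ Finset.Icc 1 m, f t = f 1 + ∑ t ∈ Finset.Icc 1 (m - 1), f (t + 1) := by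
      obtain ⟨m, rfl⟩ : ∃ j, m = j + 1 := ⟨m - 1, by omega⟩
      exact sum_Icc_succ_eq (by omega) f
    rw [← hν, first _ r (by omega)]
    refine congrArg₂ _ rfl ?_
    simp only [hS, zero_add]
    refine Finset.sum_congr (by simp) fun t _ => ?_
    rw [show 2 * (t + 1) - 1 = 2 * t + 1 by omega]
  have hex : ∃ l, S l < δ := ⟨_, Slast⟩
  classical
  -- The tail sums S count the letters `a` in later runs. The least index at which S falls below δ
  -- is the index l of the statement: before it the bound by S is no stronger than δ - 1, and from
  -- it on δ minus the subtracted terms is again a tail sum.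
  set l := Nat.find hex with hl
  have hlr : l ≤ r - 1 := Nat.find_min' hex Slast
  have hl1 : S l < δ := Nat.find_spec hex
  have hl2 : δ ≤ entry ν (2 * l + 1) + S l := by
    by_cases h0 : l = 0
    · rw [h0, mul_zero, zero_add, Sfirst]
      exact hδd
    · have := not_lt.1 (Nat.find_min hex (m := l - 1) (by omega))
      simp only [hS] at this ⊢
      rwa [show l - 1 + 1 = l by omega, sum_Icc_eq_add hlr] at this
  have split (m : ℕ) (hm : l + m ≤ r - 1) :
      S l - ∑ e ∈ Finset.Icc 1 m, entry ν (2 * l + 2 * e + 1) = S (l + m) := by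
    induction m with
    | zero => simp
    | succ m ih =>
      rw [Finset.sum_Icc_succ_top (by omega), ← sub_sub, ih (by omega)]
      simp only [hS]
      rw [sum_Icc_eq_add (by omega), show 2 * (l + m + 1) + 1 = 2 * l + 2 * (m + 1) + 1 by ring,
        add_sub_cancel_left, show l + (m + 1) = l + m + 1 by ring]
  refine ⟨l, Finset.mem_range.2 (by omega), δ - S l, Finset.mem_Icc.2 ⟨by omega, by omega⟩,
    (sub_add_cancel _ _).symm, fun t ht => ?_, fun hlt => ?_, fun s _ hodd h3 hs => ?_⟩
  · rw [Finset.mem_Icc] at ht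
    exact bound t ht.1 (by omega)
  · have b1 := Finset.mem_Icc.1 (bound (2 * l + 1) (by omega) (by omega))
    have b2 := Finset.mem_Icc.1 (bound (2 * l + 2) (by omega) (by omega))
    obtain ⟨c1, c2⟩ := height (e := l + 1) (by omega) (by omega)
    rw [show 2 * (l + 1) - 1 = 2 * l + 1 by omega, mul_add, mul_one] at c1
    rw [mul_add, mul_one] at c2
    rw [sub_sub_cancel, Finset.mem_Icc, Finset.mem_Icc]
    change _ ≤ S l at c2
    omega
  · obtain ⟨m, rfl⟩ := hodd
    have b1 := Finset.mem_Icc.1 (bound (2 * l + (2 * m + 1)) (by omega) (by omega))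
    have b2 := Finset.mem_Icc.1 (bound (2 * l + (2 * m + 1) + 1) (by omega) (by omega))
    obtain ⟨c1, c2⟩ := height (e := l + m + 1) (by omega) (by omega)
    rw [show 2 * (l + m + 1) - 1 = 2 * l + (2 * m + 1) by omega,
      show 2 * (l + m + 1) = 2 * l + (2 * m + 1) + 1 by ring] at c1
    rw [show 2 * (l + m + 1) = 2 * l + (2 * m + 1) + 1 by ring] at c2
    rw [sub_sub_cancel, show (2 * m + 1 - 1) / 2 = m by omega, split m (by omega), Finset.mem_Icc,
      Finset.mem_Icc]
    change _ ≤ S (l + m) at c2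
    omega

theorem sum_blockTuples {g l₁ l₂ k : ℤ} {r : ℕ} (hr : 2 ≤ r) (h1 : l₂ < l₁) (h2 : l₁ ≤ k) :
    ∑ ν ∈ blockTuples r g (k - l₂), ∑ σ ∈ offsetTuples r (l₁ - l₂) ν,
        binom (entry ν 1 - 1) (l₂ - l₁ + entry ν 1 + entry σ 1) *
        binom (entry ν 2) (entry σ 2 - entry σ 1) *
        binom (entry ν (2 * r - 1) - 1) (entry ν (2 * r - 1) - entry σ (2 * r - 2)) *
        ∏ e ∈ Finset.Icc 2 (r - 1),
          (binom (entry ν (2 * e - 1))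
            (entry ν (2 * e - 1) + entry σ (2 * e - 1) - entry σ (2 * e - 2)) *
          binom (entry ν (2 * e)) (entry σ (2 * e) - entry σ (2 * e - 1))) =
      blockSum g (l₁ - l₂) (fun n s => binom (n - 1) (l₁ - l₂ - 1 - s)) r (k - l₂)
        (g - (k - l₂)) := by
  have hw (ν : Fin (2 * r - 1) → ℤ) (σ : Fin (2 * r - 2) → ℤ) :
      binom (entry ν 1 - 1) (l₂ - l₁ + entry ν 1 + entry σ 1) *
        binom (entry ν 2) (entry σ 2 - entry σ 1) *
        binom (entry ν (2 * r - 1) - 1) (entry ν (2 * r - 1) - entry σ (2 * r - 2)) *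
        ∏ e ∈ Finset.Icc 2 (r - 1),
          (binom (entry ν (2 * e - 1))
            (entry ν (2 * e - 1) + entry σ (2 * e - 1) - entry σ (2 * e - 2)) *
          binom (entry ν (2 * e)) (entry σ (2 * e) - entry σ (2 * e - 1))) =
      runWeight (fun n s => binom (n - 1) (l₁ - l₂ - 1 - s)) r (entry ν) (entry σ) := by
    rw [runWeight, ← binom_symm (a := entry ν 1 - 1) (b := l₁ - l₂ - 1 - entry σ 1),
      show entry ν 1 - 1 - (l₁ - l₂ - 1 - entry σ 1) = l₂ - l₁ + entry ν 1 + entry σ 1 by ring]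
  simp only [hw]
  rw [blockTuples, Finset.sum_filter, blockSum, tupleSum]
  refine Finset.sum_congr rfl fun ν _ => ?_
  have hc := sum_odd_add_sum_even (entry ν) (r := r) (by omega)
  by_cases h : ∑ t ∈ Finset.Icc 1 r, entry ν (2 * t - 1) = k - l₂ ∧
      ∑ t ∈ Finset.Icc 1 (r - 1), entry ν (2 * t) = g - (k - l₂)
  · rw [if_pos h, if_pos ⟨by omega, h⟩, offsetTuples, tupleSum]
    -- Only one implication is needed: every nonzero term satisfies the offset conditions, so
    -- filtering by them leaves the sum unchanged.
    refine Finset.sum_filter_of_ne fun σ hσ hne => ?_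
    exact offsetCond_of_runWeight_ne_zero hr (by omega) (by omega) h.1 hσ hne
  · rw [if_neg h, if_neg fun h' => h h'.2]

theorem tripleSum_eq {g l₁ l₂ k : ℤ} (h1 : l₂ + 2 ≤ l₁) (h2 : l₁ ≤ k) (h3 : k - l₂ < g) :
    tripleSum g l₁ l₂ k =
      walkCount (l₁ - l₂) (l₁ - l₂ - 1) (k - l₂ - 1) (g - (k - l₂)) := by
  -- The first word of the pair begins and ends with `a`, so r runs of `a` give 2r - 1 runs in all
  -- and r ≤ (g + 1) / 2. The value r = 1 needs a word without `b`, excluded by k - l₂ < g.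
  obtain ⟨R, hR⟩ : ∃ R : ℕ, (g + 1) / 2 = R + 1 := ⟨((g + 1) / 2 - 1).toNat, by omega⟩
  rw [walkCount_eq_sum_blockSum (M := g) R (by omega) (by omega) (by omega) (by omega) (by omega),
    tripleSum, Finset.sum_congr rfl fun r hr =>
      sum_blockTuples (Finset.mem_Icc.1 hr).1 (by omega) h2, hR,
    show ((R : ℤ) + 1).toNat = R + 1 by omega]
  refine Finset.sum_bij' (fun r _ => r - 2) (fun r _ => r + 2) ?_ ?_ ?_ ?_ ?_ <;>
    simp only [Finset.mem_Icc, Finset.mem_range] <;> intro r hr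
  · omega
  · omega
  · omega
  · omega
  · rw [show r - 2 + 2 = r by omega]

theorem numTriples_onLine {a g : ℕ} {l₁ l₂ k : ℤ} (hg : 1 ≤ g) (h1 : l₂ + 2 ≤ l₁) (h2 : l₁ ≤ k)
    (h3 : k ≤ g + l₂) :
    numTriples (onLine a l₂) (onLine a l₁) (onLine (a + g) k) =
      if a + g - k = a - l₂ then binom (g - 2) (k - l₁) else tripleSum g l₁ l₂ k := by
  rw [numTriples_eq (N := g) (by simp only [onLine]; ring) (by simp only [onLine]; ring),
    ncard_confinedWords hg (δ := l₁ - l₂) (by omega) (by simp only [onLine]; ring)]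
  simp only [onLine]
  split_ifs with h
  · rw [show (g : ℤ) - (k - l₂) = 0 by omega, walkCount_zero_right (by omega) (by omega),
      ← binom_symm, show k - l₂ - 1 - 1 = (g : ℤ) - 2 by omega,
      show (g : ℤ) - 2 - (l₁ - l₂ - 1 - 1) = k - l₁ by omega]
  · rw [tripleSum_eq h1 h2 (by omega)]

theorem numDiverging_onLine {a : ℕ} {l₁ l₂ : ℤ} (ha : 1 ≤ a) (h : l₂ ≤ l₁) :
    (numDiverging (0, 0) (onLine a l₁) (onLine a l₂) : ℚ) =
      ((l₁ - l₂ : ℤ) : ℚ) / ((a : ℤ) : ℚ) * binom a l₁ * binom a l₂ := by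
  have key := mul_ncard_convergingWords ha h
  rw [numDiverging_eq (N := a) (by simp [onLine]) (by simp [onLine]), ncard_divergingWords]
  simp only [onLine, sub_zero]
  have : ((a : ℤ) : ℚ) ≠ 0 := by simp; omega
  field_simp
  rw [mul_comm (a : ℤ)] at key
  exact_mod_cast key

theorem numConverging_onLine {b c : ℕ} {k k' m : ℤ} (hc : 1 ≤ c) (h : k ≤ k') :
    (numConverging (onLine b k) (onLine b k') (onLine (b + c) m) : ℚ) =
      ((k' - k : ℤ) : ℚ) / ((c : ℤ) : ℚ) * binom c (m - k) * binom c (m - k') := by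
  have key := mul_ncard_convergingWords hc (x := m - k) (y := m - k') (by omega)
  rw [numConverging_eq (N := c) (by simp [onLine]) (by simp [onLine])]
  simp only [onLine]
  have : ((c : ℤ) : ℚ) ≠ 0 := by simp; omega
  rw [show m - k - (m - k') = k' - k by ring] at key
  field_simp
  rw [mul_comm (c : ℤ)] at key
  exact_mod_cast key

/-! ### Decomposition of a pair of words at its shortest borders -/

/-- Pairs of words of length `a + g + c` whose counts of `a` in prefixes of length `t` first agree
at `t = a + g`, and whose counts in suffixes of length `t` first agree at `t = g + c`. -/
def overlapWords (a g c : ℕ) : Set (Word × Word) :=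
  {w | w.1.length = a + g + c ∧ w.2.length = a + g + c ∧
    (∀ t, 0 < t → t < a + g → cnt (w.1.take t) ≠ cnt (w.2.take t)) ∧
    cnt (w.1.take (a + g)) = cnt (w.2.take (a + g)) ∧
    (∀ t, a < t → t < a + g + c →
      cnt (w.1.take t) - cnt (w.2.take t) ≠ cnt w.1 - cnt w.2) ∧
    cnt (w.1.take a) - cnt (w.2.take a) = cnt w.1 - cnt w.2}

/-- The pairs in `overlapWords` whose first word is the one with more letters `a` at the start. -/
def upperWords (a g c : ℕ) : Set (Word × Word) :=
  {w ∈ overlapWords a g c | cnt (w.2.take a) < cnt (w.1.take a)}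

theorem finite_overlapWords (a g c : ℕ) : (overlapWords a g c).Finite :=
  finite_of_length _ fun _ hw => ⟨hw.1, hw.2.1⟩

/-- The difference of the counts at time `a` is nonzero because 0 < a < a + g, and exchanging the
two words changes its sign. -/
theorem ncard_overlapWords {a g c : ℕ} (ha : 1 ≤ a) (hg : 1 ≤ g) :
    (overlapWords a g c).ncard = 2 * (upperWords a g c).ncard := by
  have hU : overlapWords a g c = upperWords a g c ∪ Prod.swap '' upperWords a g c := by
    ext ⟨u, v⟩
    simp only [Set.mem_union, Set.mem_image, Prod.exists, Prod.swap_prod_mk, Prod.mk.injEq]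
    constructor
    · intro h
      rcases lt_or_gt_of_ne (h.2.2.1 a ha (by omega)) with hlt | hlt
      · right
        obtain ⟨h1, h2, h3, h4, h5, h6⟩ := h
        dsimp only at *
        exact ⟨v, u, ⟨⟨h2, h1, fun t h h' => (h3 t h h').symm, h4.symm,
          fun t h h' he => h5 t h h' (by dsimp only at he; linarith), by dsimp only; linarith⟩, hlt⟩,
          rfl, rfl⟩
      · exact Or.inl ⟨h, hlt⟩
    · rintro (h | ⟨v, u, ⟨⟨h1, h2, h3, h4, h5, h6⟩, hlt⟩, rfl, rfl⟩)
      · exact h.1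
      · dsimp only at *
        exact ⟨h2, h1, fun t h h' => (h3 t h h').symm, h4.symm,
          fun t h h' he => h5 t h h' (by dsimp only at he; linarith), by dsimp only; linarith⟩
  have hfin : (upperWords a g c).Finite := (finite_overlapWords a g c).subset fun _ h => h.1
  rw [hU, Set.ncard_union_eq _ hfin (hfin.image _),
    Set.ncard_image_of_injective _ Prod.swap_injective, two_mul]
  rw [Set.disjoint_left]
  rintro ⟨u, v⟩ h ⟨⟨v', u'⟩, h', he⟩
  rw [Prod.swap_prod_mk, Prod.mk.injEq] at he
  obtain ⟨rfl, rfl⟩ := he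
  exact lt_asymm h.2 h'.2

theorem cnt_take_add (w : Word) (s t : ℕ) :
    cnt (w.take (s + t)) = cnt (w.take s) + cnt ((w.drop s).take t) := by
  rw [List.take_add, cnt_append]

theorem cnt_take_add_bounds (w : Word) (s t : ℕ) :
    cnt (w.take s) ≤ cnt (w.take (s + t)) ∧ cnt (w.take (s + t)) ≤ cnt (w.take s) + t := by
  rw [cnt_take_add]
  have h1 := cnt_nonneg ((w.drop s).take t)
  have h2 := cnt_le_length ((w.drop s).take t)
  have h3 : ((w.drop s).take t).length ≤ t := List.length_take_le _ _
  omega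

/-- These are the ranges of l₂, l₁, k and m. All but one come from counting letters in a block; the
exception is l₁ ≥ l₂ + 2. A difference of 1 at time `a` may be neither 0 nor 1 one step later, so it
would exceed 1 and could not come back to 0. -/
theorem upperWords_bounds {a g c : ℕ} (hg : 2 ≤ g) (hc : 1 ≤ c) {w : Word × Word}
    (hw : w ∈ upperWords a g c) :
    0 ≤ cnt (w.2.take a) ∧ cnt (w.1.take a) ≤ a ∧ cnt (w.2.take a) + 2 ≤ cnt (w.1.take a) ∧
      cnt (w.1.take a) ≤ cnt (w.1.take (a + g)) ∧
      cnt (w.1.take (a + g)) ≤ g + cnt (w.2.take a) ∧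
      cnt (w.1.take (a + g)) + cnt (w.1.take a) - cnt (w.2.take a) ≤ cnt w.1 ∧
      cnt w.1 ≤ c + cnt (w.1.take (a + g)) := by
  obtain ⟨⟨h1, h2, h3, h4, h5, h6⟩, hlt⟩ := hw
  have e1 : w.1.take (a + g + c) = w.1 := by rw [← h1, List.take_length]
  have e2 : w.2.take (a + g + c) = w.2 := by rw [← h2, List.take_length]
  have b1 := cnt_take_add_bounds w.1 0 a
  have b2 := cnt_take_add_bounds w.1 a g
  have b3 := cnt_take_add_bounds w.1 (a + g) c
  have b4 := cnt_take_add_bounds w.2 a g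
  have b5 := cnt_take_add_bounds w.2 (a + g) c
  rw [e1] at b3
  rw [e2] at b5
  simp only [zero_add, List.take_zero, cnt_nil] at b1
  have b6 := cnt_nonneg (w.2.take a)
  refine ⟨b6, b1.2, ?_, b2.1, by omega, by omega, by omega⟩
  by_contra hcon
  set f : ℕ → ℤ := fun t => cnt (w.1.take t) - cnt (w.2.take t) with hf
  have down (t : ℕ) : f t - 1 ≤ f (t + 1) := by
    have := cnt_take_succ_sub w.1 t
    have := cnt_take_succ_sub w.2 t
    simp only [hf]; omega
  have fa : f a = 1 := by simp only [hf]; omega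
  have hne (t : ℕ) (h : a + 1 ≤ t) (h' : t ≤ a + g) : f t ≠ 1 := by
    have := h5 t (by omega) (by omega)
    simp only [hf]; omega
  have := hne (a + 1) le_rfl (by omega)
  have := down a
  have : f (a + 1) ≠ 0 := by
    have := h3 (a + 1) (by omega) (by omega)
    simp only [hf]; omega
  have := stays_above (c := 1) down (s := a + 1) (e := a + g) (by omega) hne (t := a + g) (by omega)
    le_rfl
  simp only [hf] at this
  omega

theorem cnt_take_three {p q r : Word} {a g : ℕ} (hp : p.length = a) (hq : q.length = g) (t : ℕ) :
    cnt ((p ++ q ++ r).take t) =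
      cnt (p.take t) + cnt (q.take (t - a)) + cnt (r.take (t - (a + g))) := by
  rw [List.take_append, List.take_append, cnt_append, cnt_append, List.length_append, hp, hq]

theorem ncard_upperWords_fiber {a g c : ℕ} (ha : 1 ≤ a) (hg : 1 ≤ g) (hc : 1 ≤ c)
    {l₁ l₂ k m : ℤ} (h : l₂ < l₁) :
    {w ∈ upperWords a g c | cnt (w.2.take a) = l₂ ∧ cnt (w.1.take a) = l₁ ∧
        cnt (w.1.take (a + g)) = k ∧ cnt w.1 = m}.ncard =
      (divergingWords a l₁ l₂).ncard * (confinedWords g (k - l₂) (k - l₁)).ncard *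
        (convergingWords c (m - k) (m - (k + l₁ - l₂))).ncard := by
  -- The middle components are crossed: a confined pair lists first the path from A_{l₂}, which
  -- belongs to the second word.
  set φ : ((Word × Word) × (Word × Word)) × (Word × Word) → Word × Word :=
    fun x => (x.1.1.1 ++ x.1.2.2 ++ x.2.1, x.1.1.2 ++ x.1.2.1 ++ x.2.2) with hφ
  rw [← Set.ncard_prod, ← Set.ncard_prod, ← Set.InjOn.ncard_image (f := φ)]
  · congr 1
    ext ⟨u, v⟩
    constructor
    · rintro ⟨⟨⟨h1, h2, h3, h4, h5, h6⟩, -⟩, rfl, rfl, rfl, rfl⟩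
      dsimp only at *
      have hu : u = u.take a ++ (u.drop a).take g ++ u.drop (a + g) := by
        rw [← List.take_add, List.take_append_drop]
      have hv : v = v.take a ++ (v.drop a).take g ++ v.drop (a + g) := by
        rw [← List.take_add, List.take_append_drop]
      have u1 (s : ℕ) := cnt_take_add u a s
      have v1 (s : ℕ) := cnt_take_add v a s
      have u2 (s : ℕ) := cnt_take_add u (a + g) s
      have v2 (s : ℕ) := cnt_take_add v (a + g) s
      have u3 := cnt_take_add_drop (a + g) u
      have v3 := cnt_take_add_drop (a + g) v
      have tt (w : Word) (s t : ℕ) (hs : s ≤ t) : (w.take t).take s = w.take s := by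
        rw [List.take_take, min_eq_left hs]
      refine ⟨(((u.take a, v.take a), ((v.drop a).take g, (u.drop a).take g)),
        (u.drop (a + g), v.drop (a + g))), ⟨⟨?_, ?_⟩, ?_⟩, ?_⟩
      · refine ⟨by simp; omega, by simp; omega, rfl, rfl, fun t ht h0 => ?_⟩
        dsimp only
        rw [tt _ _ _ ht, tt _ _ _ ht]
        exact h3 t (by omega) (by omega)
      · refine ⟨by simp; omega, by simp; omega, ?_, ?_, fun t ht h0 => ?_, fun t ht h0 => ?_⟩
        · have := v1 g; dsimp only; omega
        · have := u1 g; dsimp only; omega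
        · dsimp only
          rw [tt _ _ _ ht, tt _ _ _ ht]
          have := h3 (a + t) (by omega) (by omega)
          have := v1 t
          have := u1 t
          omega
        · dsimp only
          rw [tt _ _ _ ht, tt _ _ _ ht]
          have := h5 (a + t) (by omega) (by omega)
          have := v1 t
          have := u1 t
          omega
      · refine ⟨by simp; omega, by simp; omega, ?_, ?_, fun t ht h0 => ?_⟩
        · dsimp only; omega
        · dsimp only; omega
        · dsimp only
          have := h5 (a + g + t) (by omega) (by omega)
          have := v2 t
          have := u2 t
          omega
      · rw [hφ]
        exact Prod.ext hu.symm hv.symm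
    · rintro ⟨⟨⟨⟨p₁, q₁⟩, ⟨p₂, q₂⟩⟩, ⟨p₃, q₃⟩⟩, ⟨⟨⟨a1, a2, a3, a4, a5⟩, b1, b2, b3, b4, b5, b6⟩,
        c1, c2, c3, c4, c5⟩, he⟩
      simp only [hφ, Prod.mk.injEq] at *
      obtain ⟨rfl, rfl⟩ := he
      have U (t : ℕ) := cnt_take_three (r := p₃) a1 b2 t
      have V (t : ℕ) := cnt_take_three (r := q₃) a2 b1 t
      have tl (w : Word) (t : ℕ) (h : w.length ≤ t) : w.take t = w := List.take_of_length_le h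
      have z1 (w : Word) (s t : ℕ) (h : s ≤ t) : cnt (w.take (s - t)) = 0 := by
        rw [Nat.sub_eq_zero_of_le h, List.take_zero, cnt_nil]
      have Ulow (t : ℕ) (ht : t ≤ a) : cnt ((p₁ ++ q₂ ++ p₃).take t) = cnt (p₁.take t) := by
        rw [U, z1 _ _ _ ht, z1 _ _ _ (by omega), add_zero, add_zero]
      have Vlow (t : ℕ) (ht : t ≤ a) : cnt ((q₁ ++ p₂ ++ q₃).take t) = cnt (q₁.take t) := by
        rw [V, z1 _ _ _ ht, z1 _ _ _ (by omega), add_zero, add_zero]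
      have Umid (s : ℕ) (hs : s ≤ g) :
          cnt ((p₁ ++ q₂ ++ p₃).take (a + s)) = l₁ + cnt (q₂.take s) := by
        rw [U, tl p₁ _ (by omega), a3, z1 p₃ (a + s) (a + g) (by omega), add_zero,
          Nat.add_sub_cancel_left]
      have Vmid (s : ℕ) (hs : s ≤ g) :
          cnt ((q₁ ++ p₂ ++ q₃).take (a + s)) = l₂ + cnt (p₂.take s) := by
        rw [V, tl q₁ _ (by omega), a4, z1 q₃ (a + s) (a + g) (by omega), add_zero,
          Nat.add_sub_cancel_left]
      have Uhigh (s : ℕ) : cnt ((p₁ ++ q₂ ++ p₃).take (a + g + s)) = k + cnt (p₃.take s) := by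
        rw [U, tl p₁ _ (by omega), tl q₂ _ (by omega), a3, b4, Nat.add_sub_cancel_left]
        ring
      have Vhigh (s : ℕ) : cnt ((q₁ ++ p₂ ++ q₃).take (a + g + s)) = k + cnt (q₃.take s) := by
        rw [V, tl q₁ _ (by omega), tl p₂ _ (by omega), a4, b3, Nat.add_sub_cancel_left]
        ring
      have Ua := Umid 0 (Nat.zero_le _)
      have Va := Vmid 0 (Nat.zero_le _)
      have Uag := Uhigh 0
      have Vag := Vhigh 0
      simp only [add_zero, List.take_zero, cnt_nil] at Ua Va Uag Vag
      have Uend : cnt (p₁ ++ q₂ ++ p₃) = m := by simp only [cnt_append]; omega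
      have Vend : cnt (q₁ ++ p₂ ++ q₃) = m - (l₁ - l₂) := by simp only [cnt_append]; omega
      refine ⟨⟨⟨?_, ?_, fun t h0 ht => ?_, ?_, fun t h0 ht => ?_, ?_⟩, ?_⟩, ?_⟩
      · simp only [List.length_append]; omega
      · simp only [List.length_append]; omega
      · dsimp only
        by_cases hta : t ≤ a
        · rw [Ulow t hta, Vlow t hta]
          exact a5 t hta (by omega)
        · obtain ⟨s, rfl⟩ : ∃ s, t = a + s := ⟨t - a, by omega⟩
          rw [Umid s (by omega), Vmid s (by omega)]
          have := b5 s (by omega) (by omega)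
          omega
      · dsimp only; omega
      · dsimp only
        rw [Uend, Vend]
        by_cases hta : t ≤ a + g
        · obtain ⟨s, rfl⟩ : ∃ s, t = a + s := ⟨t - a, by omega⟩
          rw [Umid s (by omega), Vmid s (by omega)]
          have := b6 s (by omega) (by omega)
          omega
        · obtain ⟨s, rfl⟩ : ∃ s, t = a + g + s := ⟨t - (a + g), by omega⟩
          rw [Uhigh s, Vhigh s]
          have := c5 s (by omega) (by omega)
          omega
      · dsimp only; omega
      · dsimp only; omega
      · exact ⟨Va, Ua, Uag, Uend⟩
  · rintro ⟨⟨⟨p₁, q₁⟩, ⟨p₂, q₂⟩⟩, ⟨p₃, q₃⟩⟩ ⟨⟨⟨a1, a2, -⟩, b1, b2, -⟩, c1, c2, -⟩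
      ⟨⟨⟨p₁', q₁'⟩, ⟨p₂', q₂'⟩⟩, ⟨p₃', q₃'⟩⟩ ⟨⟨⟨a1', a2', -⟩, b1', b2', -⟩, c1', c2', -⟩ he
    simp only [hφ, Prod.mk.injEq] at *
    obtain ⟨e1, e2⟩ := he
    obtain ⟨f1, rfl⟩ := List.append_inj e1 (by simp only [List.length_append]; omega)
    obtain ⟨rfl, rfl⟩ := List.append_inj f1 (by omega)
    obtain ⟨f2, rfl⟩ := List.append_inj e2 (by simp only [List.length_append]; omega)
    obtain ⟨rfl, rfl⟩ := List.append_inj f2 (by omega)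
    simp

theorem ncard_upperWords {a g c : ℕ} (ha : 1 ≤ a) (hg : 2 ≤ g) (hc : 1 ≤ c) :
    (upperWords a g c).ncard = ∑ l₂ ∈ Finset.Icc 0 ((a : ℤ) - 2), ∑ l₁ ∈ Finset.Icc (l₂ + 2) (a : ℤ),
      ∑ k ∈ Finset.Icc l₁ (g + l₂), ∑ m ∈ Finset.Icc (k + l₁ - l₂) (c + k),
        numDiverging (0, 0) (onLine a l₁) (onLine a l₂) *
        numTriples (onLine a l₂) (onLine a l₁) (onLine (a + g) k) *
        numConverging (onLine (a + g) k) (onLine (a + g) (k + l₁ - l₂)) (onLine (a + g + c) m) := by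
  have hfin : (upperWords a g c).Finite := (finite_overlapWords a g c).subset fun _ h => h.1
  rw [ncard_eq_sum_fiber hfin (Finset.Icc 0 ((a : ℤ) - 2)) fun w => cnt (w.2.take a)]
  swap
  · intro w hw
    have := upperWords_bounds hg hc hw
    rw [Finset.mem_Icc]
    omega
  refine Finset.sum_congr rfl fun l₂ _ => ?_
  rw [ncard_eq_sum_fiber (hfin.subset fun _ h => h.1) (Finset.Icc (l₂ + 2) (a : ℤ))
    fun w => cnt (w.1.take a)]
  swap
  · rintro w ⟨hw, rfl⟩
    have := upperWords_bounds hg hc hw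
    rw [Finset.mem_Icc]
    omega
  refine Finset.sum_congr rfl fun l₁ hl₁ => ?_
  rw [ncard_eq_sum_fiber (hfin.subset fun _ h => h.1.1) (Finset.Icc l₁ (g + l₂))
    fun w => cnt (w.1.take (a + g))]
  swap
  · rintro w ⟨⟨hw, rfl⟩, rfl⟩
    have := upperWords_bounds hg hc hw
    rw [Finset.mem_Icc]
    omega
  refine Finset.sum_congr rfl fun k _ => ?_
  rw [ncard_eq_sum_fiber (hfin.subset fun _ h => h.1.1.1) (Finset.Icc (k + l₁ - l₂) (c + k))
    fun w => cnt w.1]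
  swap
  · rintro w ⟨⟨⟨hw, rfl⟩, rfl⟩, rfl⟩
    have := upperWords_bounds hg hc hw
    rw [Finset.mem_Icc]
    omega
  refine Finset.sum_congr rfl fun m _ => ?_
  rw [Finset.mem_Icc] at hl₁
  have key := ncard_upperWords_fiber ha (by omega : 1 ≤ g) hc (k := k) (m := m)
    (by omega : l₂ < l₁)
  rw [numDiverging_eq (N := a) (by simp [onLine]) (by simp [onLine]),
    numTriples_eq (N := g) (by simp only [onLine]; ring) (by simp only [onLine]; ring),
    numConverging_eq (N := c) (by simp only [onLine]; ring) (by simp only [onLine]; ring)]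
  simp only [onLine, sub_zero]
  rw [← key]
  congr 1
  ext w
  constructor
  · rintro ⟨⟨⟨⟨h, h1⟩, h2⟩, h3⟩, h4⟩
    exact ⟨h, h1, h2, h3, h4⟩
  · rintro ⟨h, h1, h2, h3, h4⟩
    exact ⟨⟨⟨⟨h, h1⟩, h2⟩, h3⟩, h4⟩

/-! ### Shortest borders -/

theorem AbelianEquiv.length_eq {x y : Word} (h : AbelianEquiv x y) : x.length = y.length := by
  have h1 := h true
  have h2 := h false
  have h3 := count_false x
  have h4 := count_false y
  simp only [cnt] at *
  omega

theorem abelianEquiv_iff {x y : Word} (h : x.length = y.length) :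
    AbelianEquiv x y ↔ cnt x = cnt y := by
  constructor
  · intro h
    simp only [cnt, h true]
  · intro hc c
    have h3 := count_false x
    have h4 := count_false y
    cases c
    · omega
    · simpa [cnt] using hc

theorem exists_internalBorder_iff {u v : Word} {n t : ℕ} (hu : u.length = n) (hv : v.length = n) :
    (∃ x y, IsInternalBorder u v x y ∧ x.length = t) ↔
      0 < t ∧ t < n ∧ cnt (u.drop (n - t)) = cnt (v.take t) := by
  constructor
  · rintro ⟨x, y, ⟨⟨hx, hxu, hne⟩, ⟨hyv, -⟩, he⟩, rfl⟩
    have hl := he.length_eq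
    have hlt : x.length < n := by
      refine lt_of_le_of_ne (hu ▸ hxu.length_le) fun h => hne (hxu.eq_of_length (h.trans hu.symm))
    refine ⟨List.length_pos_of_ne_nil hx, hlt, ?_⟩
    have e1 := List.suffix_iff_eq_drop.1 hxu
    have e2 := List.prefix_iff_eq_take.1 hyv
    rw [hu] at e1
    rw [← e1, hl, ← e2, (abelianEquiv_iff hl).1 he]
  · rintro ⟨h0, hn, he⟩
    have l1 : (u.drop (n - t)).length = t := by rw [List.length_drop]; omega
    have l2 : (v.take t).length = t := by rw [List.length_take]; omega
    refine ⟨u.drop (n - t), v.take t, ⟨⟨?_, List.drop_suffix _ _, ?_⟩, ⟨List.take_prefix _ _, ?_⟩,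
      (abelianEquiv_iff (l1.trans l2.symm)).2 he⟩, l1⟩
    · intro h
      rw [h, List.length_nil] at l1
      omega
    · intro h
      rw [h] at l1
      omega
    · intro h
      rw [h] at l2
      omega

theorem exists_externalBorder_iff {u v : Word} :
    (∃ x y, IsExternalBorder u v x y) ↔ ∃ x y, IsInternalBorder v u x y := by
  have nil {x y : Word} (h : AbelianEquiv x y) (hx : x ≠ []) : y ≠ [] := by
    rintro rfl
    exact hx (List.length_eq_zero_iff.1 h.length_eq)
  constructor
  · rintro ⟨x, y, ⟨hx, h1, h2⟩, ⟨h3, h4⟩, he⟩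
    exact ⟨y, x, ⟨nil he hx, h3, h4⟩, ⟨h1, h2⟩, fun c => (he c).symm⟩
  · rintro ⟨x, y, ⟨hx, h1, h2⟩, ⟨h3, h4⟩, he⟩
    exact ⟨y, x, ⟨nil he hx, h3, h4⟩, ⟨h1, h2⟩, fun c => (he c).symm⟩

/-- Existence is kept together with the value because `lsb` takes the default 0 when no border
exists. -/
theorem exists_internalBorder_and_lsb_eq {u v : Word} {n i : ℕ} (hu : u.length = n)
    (hv : v.length = n) : ((∃ x y, IsInternalBorder u v x y) ∧ lsb u v = i) ↔
      (0 < i ∧ i < n ∧ cnt (u.drop (n - i)) = cnt (v.take i)) ∧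
        ∀ t, 0 < t → t < i → cnt (u.drop (n - t)) ≠ cnt (v.take t) := by
  have hS : {t : ℕ | ∃ x y, IsInternalBorder u v x y ∧ x.length = t} =
      {t : ℕ | 0 < t ∧ t < n ∧ cnt (u.drop (n - t)) = cnt (v.take t)} :=
    Set.ext fun t => exists_internalBorder_iff hu hv
  rw [lsb, hS]
  constructor
  · rintro ⟨⟨x, y, hb⟩, rfl⟩
    have hne : {t : ℕ | 0 < t ∧ t < n ∧ cnt (u.drop (n - t)) = cnt (v.take t)}.Nonempty :=
      hS ▸ ⟨x.length, x, y, hb, rfl⟩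
    have hmem := Nat.sInf_mem hne
    exact ⟨hmem, fun t h0 ht he => Nat.notMem_of_lt_sInf ht ⟨h0, ht.trans hmem.2.1, he⟩⟩
  · rintro ⟨h, hmin⟩
    obtain ⟨x, y, hb, -⟩ := (exists_internalBorder_iff hu hv).2 h
    refine ⟨⟨x, y, hb⟩, le_antisymm (Nat.sInf_le h) (le_csInf ⟨i, h⟩ ?_)⟩
    rintro t ⟨h0, -, he⟩
    by_contra hlt
    exact hmin t h0 (not_le.1 hlt) he

theorem lsb_mem_Icc {n : ℕ} {w : Word × Word} (hw : w ∈ mabPairs n) :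
    (lsb w.1 w.2 : ℤ) ∈ Finset.Icc 1 ((n : ℤ) - 1) ∧
      (lsb w.2 w.1 : ℤ) ∈ Finset.Icc 1 ((n : ℤ) - 1) := by
  obtain ⟨h1, h2, hi, he⟩ := hw
  rw [exists_externalBorder_iff] at he
  have b1 := ((exists_internalBorder_and_lsb_eq h1 h2).1 ⟨hi, rfl⟩).1
  have b2 := ((exists_internalBorder_and_lsb_eq h2 h1).1 ⟨he, rfl⟩).1
  simp only [Finset.mem_Icc]
  omega

/-- Reversing the second word turns its suffixes into prefixes, so both kinds of border become
coincidences between two paths read from the same point. -/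
theorem ncard_mabPairs_fiber {a g c : ℕ} (ha : 1 ≤ a) (hg : 1 ≤ g) (hc : 1 ≤ c) :
    {w ∈ mabPairs (a + g + c) | lsb w.1 w.2 = g + c ∧ lsb w.2 w.1 = a + g}.ncard =
      (overlapWords a g c).ncard := by
  have hinj : Function.Injective (fun w : Word × Word => (w.1, w.2.reverse)) := by
    rintro ⟨p, q⟩ ⟨p', q'⟩ h
    simpa using h
  rw [← Set.ncard_image_of_injective (overlapWords a g c) hinj]
  congr 1
  ext ⟨u, v⟩
  have hiff : (u, v) ∈ (fun w : Word × Word => (w.1, w.2.reverse)) '' overlapWords a g c ↔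
      (u, v.reverse) ∈ overlapWords a g c := by
    constructor
    · rintro ⟨⟨p, q⟩, h, he⟩
      rw [Prod.mk.injEq] at he
      obtain ⟨rfl, rfl⟩ := he
      simpa using h
    · exact fun h => ⟨_, h, by simp⟩
  have hmab : (u, v) ∈ {w ∈ mabPairs (a + g + c) | lsb w.1 w.2 = g + c ∧ lsb w.2 w.1 = a + g} ↔
      u.length = a + g + c ∧ v.length = a + g + c ∧
      ((∃ x y, IsInternalBorder u v x y) ∧ lsb u v = g + c) ∧
      ((∃ x y, IsInternalBorder v u x y) ∧ lsb v u = a + g) := by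
    constructor
    · rintro ⟨⟨h1, h2, h3, h4⟩, h5, h6⟩
      exact ⟨h1, h2, ⟨h3, h5⟩, exists_externalBorder_iff.1 h4, h6⟩
    · rintro ⟨h1, h2, ⟨h3, h5⟩, h4, h6⟩
      exact ⟨⟨h1, h2, h3, exists_externalBorder_iff.2 h4⟩, h5, h6⟩
  rw [hiff, hmab]
  obtain ⟨w, rfl⟩ : ∃ w : Word, v = w.reverse := ⟨v.reverse, by simp⟩
  rw [List.reverse_reverse]
  simp only [overlapWords, Set.mem_ofPred_eq, List.length_reverse]
  refine and_congr_right fun hu => and_congr_right fun hw => ?_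
  rw [exists_internalBorder_and_lsb_eq hu (by simpa), exists_internalBorder_and_lsb_eq (by simpa) hu]
  have take_rev (t : ℕ) (ht : t ≤ a + g + c) :
      cnt (w.reverse.take t) = cnt w - cnt (w.take (a + g + c - t)) := by
    rw [List.take_reverse, cnt_reverse, hw]
    linarith [cnt_take_add_drop (a + g + c - t) w]
  have drop_rev (t : ℕ) (ht : t ≤ a + g + c) :
      cnt (w.reverse.drop (a + g + c - t)) = cnt (w.take t) := by
    rw [List.drop_reverse, cnt_reverse, hw, Nat.sub_sub_self ht]
  have drop_u (t : ℕ) : cnt (u.drop t) = cnt u - cnt (u.take t) := by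
    linarith [cnt_take_add_drop t u]
  constructor
  · rintro ⟨⟨⟨-, -, h1⟩, h2⟩, ⟨-, -, h3⟩, h4⟩
    rw [take_rev _ (by omega), drop_u, show a + g + c - (g + c) = a by omega] at h1
    rw [drop_rev _ (by omega)] at h3
    refine ⟨fun t h0 ht => ?_, h3.symm, fun t h0 ht => ?_, by linarith⟩
    · have := h4 t h0 ht
      rw [drop_rev _ (by omega)] at this
      exact this.symm
    · have := h2 (a + g + c - t) (by omega) (by omega)
      rw [take_rev _ (by omega), drop_u, Nat.sub_sub_self (by omega)] at this
      intro h
      apply this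
      linarith
  · rintro ⟨h1, h2, h3, h4⟩
    refine ⟨⟨⟨by omega, by omega, ?_⟩, fun t h0 ht => ?_⟩, ⟨by omega, by omega, ?_⟩,
      fun t h0 ht => ?_⟩
    · rw [take_rev _ (by omega), drop_u, show a + g + c - (g + c) = a by omega]
      linarith
    · rw [take_rev _ (by omega), drop_u]
      have := h3 (a + g + c - t) (by omega) (by omega)
      intro h
      apply this
      linarith
    · rw [drop_rev _ (by omega), h2]
    · rw [drop_rev _ (by omega)]
      exact (h1 t h0 ht).symm

/-! ### Grouping the pairs by their two shortest border lengths -/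

theorem exists_parts {n : ℕ} {i j : ℤ} (hj : j ∈ Finset.Icc (1 : ℤ) (n - 1))
    (hi : i ∈ Finset.Icc (1 : ℤ) (n - 1)) (h : 3 ≤ i + j - n) :
    ∃ a g c : ℕ, 1 ≤ a ∧ 3 ≤ g ∧ 1 ≤ c ∧ n = a + g + c ∧ i = g + c ∧ j = a + g := by
  rw [Finset.mem_Icc] at hi hj
  exact ⟨(n - i).toNat, (i + j - n).toNat, (n - j).toNat, by omega, by omega, by omega, by omega,
    by omega, by omega⟩

theorem ncard_lsb_eq {n : ℕ} {i j : ℤ} (hj : j ∈ Finset.Icc (1 : ℤ) (n - 1))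
    (hi : i ∈ Finset.Icc (1 : ℤ) (n - 1)) (h : 3 ≤ i + j - n) :
    {w ∈ mabPairs n | (lsb w.1 w.2 : ℤ) = i ∧ (lsb w.2 w.1 : ℤ) = j}.ncard =
      2 * pathSum n i j := by
  obtain ⟨a, g, c, ha, hg, hc, rfl, rfl, rfl⟩ := exists_parts hj hi h
  have key := ncard_mabPairs_fiber ha (by omega : 1 ≤ g) hc
  rw [ncard_overlapWords ha (by omega), ncard_upperWords ha (by omega) hc] at key
  have hn : ((a + g + c : ℕ) : ℤ) = a + g + c := by push_cast; rfl
  rw [pathSum, hn, show (a + g + c : ℤ) - (g + c) = a by ring,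
    show (g + c : ℤ) + (a + g) - (a + g + c) = g by ring,
    show (a + g + c : ℤ) - (a + g) = c by ring, ← key]
  congr 1
  ext w
  exact and_congr_right fun _ => by omega

/-- The predicate `Q` serves both counts at once: overlap at least 3, and overlap equal to a given
g. -/
theorem ncard_overlap (n : ℕ) (Q : ℤ → Prop) [DecidablePred Q] (hQ : ∀ x, Q x → 3 ≤ x) :
    {w ∈ mabPairs n | Q (overlap n w)}.ncard =
      2 * ∑ j ∈ Finset.Icc (1 : ℤ) (n - 1),
        ∑ i ∈ Finset.Icc (1 : ℤ) (n - 1) with Q (i + j - n), pathSum n i j := by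
  have hfin : {w ∈ mabPairs n | Q (overlap n w)}.Finite :=
    finite_of_length n fun w hw => ⟨hw.1.1, hw.1.2.1⟩
  rw [ncard_eq_sum_fiber hfin (Finset.Icc (1 : ℤ) (n - 1)) (fun w => (lsb w.2 w.1 : ℤ))
    fun w hw => (lsb_mem_Icc hw.1).2, Finset.mul_sum]
  refine Finset.sum_congr rfl fun j hj => ?_
  rw [ncard_eq_sum_fiber (hfin.subset fun _ h => h.1) (Finset.Icc (1 : ℤ) (n - 1))
    (fun w => (lsb w.1 w.2 : ℤ)) fun w hw => (lsb_mem_Icc hw.1.1).1, Finset.sum_filter,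
    Finset.mul_sum]
  refine Finset.sum_congr rfl fun i hi => ?_
  split_ifs with h
  · rw [← ncard_lsb_eq hj hi (hQ _ h)]
    congr 1
    ext w
    constructor
    · rintro ⟨⟨⟨h1, h2⟩, h3⟩, h4⟩
      exact ⟨h1, h4, h3⟩
    · rintro ⟨h1, rfl, rfl⟩
      exact ⟨⟨⟨h1, h⟩, rfl⟩, rfl⟩
  · rw [mul_zero, Set.ncard_eq_zero (hfin.subset fun _ h => h.1.1)]
    refine Set.eq_empty_of_forall_notMem ?_
    rintro w ⟨⟨⟨h1, h2⟩, rfl⟩, rfl⟩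
    exact h h2

end MAB

/-- The number of mutually abelian-bordered pairs with overlap length at least 3 (in all, and for
each overlap length `g`) as a sixfold sum, together with the values of the three factors. -/
theorem theorem2p16 (n : ℕ) :
    Set.ncard {w ∈ MAB.mabPairs n | 3 ≤ MAB.overlap n w} =
      2 * ∑ j ∈ Finset.Icc (1 : ℤ) (n - 1),
        ∑ i ∈ Finset.Icc (1 : ℤ) (n - 1) with 3 ≤ i + j - n, MAB.pathSum n i j ∧
    (∀ g : ℤ, 3 ≤ g →
      Set.ncard {w ∈ MAB.mabPairs n | MAB.overlap n w = g} =
        2 * ∑ j ∈ Finset.Icc (1 : ℤ) (n - 1),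
          ∑ i ∈ Finset.Icc (1 : ℤ) (n - 1) with i + j - n = g, MAB.pathSum n i j) ∧
    (∀ j ∈ Finset.Icc (1 : ℤ) (n - 1), ∀ i ∈ Finset.Icc (1 : ℤ) (n - 1), 3 ≤ i + j - n →
      ∀ l₂ ∈ Finset.Icc (0 : ℤ) (n - i - 2), ∀ l₁ ∈ Finset.Icc (l₂ + 2) (n - i),
        (MAB.numDiverging (0, 0) (MAB.onLine (n - i) l₁) (MAB.onLine (n - i) l₂) : ℚ) =
          ((l₁ - l₂ : ℤ) : ℚ) / ((n - i : ℤ) : ℚ) *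
            MAB.binom (n - i) l₁ * MAB.binom (n - i) l₂ ∧
        ∀ k ∈ Finset.Icc l₁ (i + j - n + l₂),
          MAB.numTriples (MAB.onLine (n - i) l₂) (MAB.onLine (n - i) l₁) (MAB.onLine j k) =
            (if j - k = n - i - l₂ then MAB.binom (i + j - n - 2) (k - l₁)
              else MAB.tripleSum (i + j - n) l₁ l₂ k) ∧
          ∀ m ∈ Finset.Icc (k + l₁ - l₂) (n - j + k),
            (MAB.numConverging (MAB.onLine j k) (MAB.onLine j (k + l₁ - l₂))
                (MAB.onLine n m) : ℚ) =
              ((l₁ - l₂ : ℤ) : ℚ) / ((n - j : ℤ) : ℚ) *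
                MAB.binom (n - j) (m - k) * MAB.binom (n - j) (m - (k + l₁ - l₂))) := by
  refine ⟨MAB.ncard_overlap n (fun x => 3 ≤ x) fun _ h => h,
    fun g hg => MAB.ncard_overlap n (fun x => x = g) fun _ h => h ▸ hg,
    fun j hj i hi h l₂ hl₂ l₁ hl₁ => ?_⟩
  obtain ⟨a, g, c, ha, hg, hc, rfl, rfl, rfl⟩ := MAB.exists_parts hj hi h
  have hn : ((a + g + c : ℕ) : ℤ) = a + g + c := by push_cast; rfl
  have e1 : (a + g + c : ℤ) - (g + c) = a := by ring
  have e2 : (g + c : ℤ) + (a + g) - (a + g + c) = g := by ring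
  have e3 : (a + g + c : ℤ) - (a + g) = c := by ring
  simp only [hn, e1, e2, e3] at hl₁ ⊢
  rw [Finset.mem_Icc] at hl₁
  refine ⟨MAB.numDiverging_onLine ha (by omega), fun k hk => ?_⟩
  rw [Finset.mem_Icc] at hk
  refine ⟨MAB.numTriples_onLine (by omega) (by omega) hk.1 hk.2, fun m _ => ?_⟩
  have key := MAB.numConverging_onLine (b := a + g) (k := k) (k' := k + l₁ - l₂) (m := m) hc
    (by omega)
  rw [show k + l₁ - l₂ - k = l₁ - l₂ by ring] at key
  exact_mod_cast key
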